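/- Let $\langle x,y\rangle_H=x_1y_1+x_2y_2-x_3y_3$ on $\mathbb R^3$, let $\mathbb H^2=\{x:\langle x,x\rangle_H=-1,\ x_3>0\}$ be the hyperbolic plane with distance $d_H(x,y)=\operatorname{arcosh}(-\langle x,y\rangle_H)$ and Riemannian area measure $\sigma$. Let $\Omega\subset\mathbb H^2$ be compact and geodesically convex, let $p_1,\dots,p_N\in\Omega$ be distinct points and $r_1,\dots,r_N>0$. For $x\in\mathbb H^2$ put $\mathrm{pow}(x,c_i)=\cosh d_H(x,p_i)/\cosh r_i$, where $c_i$ is the geodesic circle with centre $p_i$ and radius $r_i$, let $$U_i=\{x\in\mathbb H^2:\ \mathrm{pow}(x,c_i)\le \mathrm{pow}(x,c_j)\ \text{for all } j\}$$ be the hyperbolic power cells, and regard the areas $w_i=\sigma(U_i\cap\Omega)$ as functions of the heights $h_j=\ln\cosh r_j$, with $\Omega$ and the centres fixed. Assume that the diagram is non-degenerate in $\Omega$: every cell with $U_i\cap\Omega\ne\varnothing$ has $w_i>0$. Then all partial derivatives $\partial w_i/\partial h_j$ exist at $h$, and $$\frac{\partial w_i}{\partial h_i}=-\sum_{j\ne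 i}\frac{\partial w_j}{\partial h_i}\quad\text{for all } i,\qquad \frac{\partial w_i}{\partial h_j}=\frac{\partial w_j}{\partial h_i}\quad\text{for all } i\ne j.$$ Moreover, let $i\neq j$ and $E=U_i\cap U_j\cap\Omega$. If $E=\varnothing$, then $\partial w_i/\partial h_j=0$. If $E\ne\varnothing$, then the Laguerre bisector $\{\mathrm{pow}(\cdot,c_i)=\mathrm{pow}(\cdot,c_j)\}$ meets the geodesic line through $p_i$ and $p_j$ perpendicularly in a point $q$, the set $E$ is a (possibly one-point) geodesic segment on the bisector, and $$\frac{\partial w_i}{\partial h_j}=-\frac{\sinh d_k+\sinh d_l}{\tanh\gamma_i+\tanh\gamma_j}.$$ Here $\gamma_i,\gamma_j$ are the signed distances from $q$ to $p_i$ and to $p_j$ along the line (positive if $q$ lies between them, and always $\gamma_i+\gamma_j=d_H(p_i,p_j)$), and $d_k,d_l$ are the signed distances from $q$ to the two end points of $E$, measured along the bisector in the two opposite directions, so that $d_k+d_l$ is the length of $E$; all four are ordinary distances when $q$ lies on $E$ and between $p_i$ and $p_j$. In particular this formula holds when $p_ip_jp_k$ and $p_ip_jp_l$ are two triangles of the weighted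 Delaunay triangulation on opposite sides of $p_ip_j$ whose power centres $o_k\in U_i\cap U_j\cap U_k\cap\Omega$ and $o_l\in U_i\cap U_j\cap U_l\cap\Omega$ lie in $\Omega$, with $d_k$ the signed distance from $q$ to $o_k$ (positive on the side of $p_k$) and $d_l$ the signed distance from $q$ to $o_l$ (positive on the side of $p_l$). -/

import Mathlib

namespace HypPower

/-- The underlying vector space of three-dimensional Minkowski space; the last coordinate is
the time-like one. -/
abbrev Mink : Type := Fin 3 → ℝ

/-- The Lorentzian inner product on Minkowski space. -/
def lor (x y : Mink) : ℝ := x 0 * y 0 + x 1 * y 1 - x 2 * y 2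

/-- The hyperbolic plane in the hyperboloid model. -/
def hypPlane : Set Mink := {x | lor x x = -1 ∧ 0 < x 2}

/-- The hyperbolic distance. -/
noncomputable def hdist (x y : Mink) : ℝ := Real.arcosh (-lor x y)

/-- `v` is a unit tangent vector of the hyperbolic plane at `x`. -/
def UnitTangent (x v : Mink) : Prop := lor x v = 0 ∧ lor v v = 1

/-- The unit-speed geodesic that starts at `x` with the velocity `v`, a unit tangent vector. -/
noncomputable def geo (x v : Mink) (s : ℝ) : Mink := Real.cosh s • x + Real.sinh s • v

/-- Geodesic convexity: the set contains the geodesic segment between any two of its points. -/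
def GeodesicallyConvex (A : Set Mink) : Prop :=
  ∀ x ∈ A, ∀ v, UnitTangent x v → ∀ t, 0 ≤ t → geo x v t ∈ A →
    ∀ s ∈ Set.Icc 0 t, geo x v s ∈ A

/-- The hyperboloid as the graph of a function of its two space-like coordinates. -/
noncomputable def chart (z : ℝ × ℝ) : Mink := ![z.1, z.2, Real.sqrt (1 + z.1 ^ 2 + z.2 ^ 2)]

/-- The Riemannian area measure of the hyperbolic plane, carried by the hyperboloid. In the
coordinates `z` the area element of the metric `dx² + dy² - dt²` restricted to the hyperboloid is
`dx dy / √(1 + x² + y²)`. -/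
noncomputable def hypArea : MeasureTheory.Measure Mink :=
  MeasureTheory.Measure.map chart
    ((MeasureTheory.volume : MeasureTheory.Measure (ℝ × ℝ)).withDensity
      fun z => ENNReal.ofReal (1 / Real.sqrt (1 + z.1 ^ 2 + z.2 ^ 2)))

/-- The chart is measurable, so that the push-forward in `hypArea` is the genuine one. -/
theorem measurable_chart : Measurable chart := by
  refine measurable_pi_iff.mpr fun i => ?_
  fin_cases i <;> simp [chart] <;> fun_prop

/-- The hyperbolic power distance from `x` to the circle with centre `c` and radius `ρ`. -/
noncomputable def pow (x c : Mink) (ρ : ℝ) : ℝ := Real.cosh (hdist x c) / Real.cosh ρ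

/-- The hyperbolic power cell of the `i`-th circle of the family `(p, r)`. -/
def cell {N : ℕ} (p : Fin N → Mink) (r : Fin N → ℝ) (i : Fin N) : Set Mink :=
  {x | x ∈ hypPlane ∧ ∀ j, pow x (p i) (r i) ≤ pow x (p j) (r j)}

/-- The common edge of the `i`-th and `j`-th cell, restricted to `Ω`. -/
def edge {N : ℕ} (Ω : Set Mink) (p : Fin N → Mink) (r : Fin N → ℝ) (i j : Fin N) : Set Mink :=
  cell p r i ∩ cell p r j ∩ Ω

/-- The radii as functions of the heights `h i = log (cosh (r i))`. -/
noncomputable def radii {N : ℕ} (h : Fin N → ℝ) : Fin N → ℝ :=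
  fun i => Real.arcosh (Real.exp (h i))

/-- The area of the `i`-th cell in `Ω` as a function of the heights. -/
noncomputable def cellArea {N : ℕ} (Ω : Set Mink) (p : Fin N → Mink) (h : Fin N → ℝ)
    (i : Fin N) : ℝ :=
  (hypArea (cell p (radii h) i ∩ Ω)).toReal

/-- `q` is the point where the Laguerre bisector of the circles `(a, ρ)` and `(b, τ)` crosses the
geodesic line through `a` and `b`; `u` is the unit tangent vector at `q` of that line in the
direction from `a` to `b`, `n` is a unit normal of it at `q` (hence a unit tangent vector of the
bisector), and `γa`, `γb` are the signed distances from `a` and `b` to `q` on the line: they are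
positive if `a` lies before `q`, respectively `b` after `q`, and their sum is the distance from `a`
to `b`. -/
structure BisectorFrame (a b : Mink) (ρ τ : ℝ) (q u n : Mink) (γa γb : ℝ) : Prop where
  mem : q ∈ hypPlane
  bisect : pow q a ρ = pow q b τ
  tangent : UnitTangent q u
  normal : UnitTangent q n
  orth : lor u n = 0
  left : a = geo q u (-γa)
  right : b = geo q u γb
  pos : 0 < γa + γb

end HypPower

/-!
Write `c k = 1 / cosh (r k) = exp (-h k)`. On the hyperboloid `pow x (p k) (r k)` equals
`-c k * lor x (p k)`, so the `i`-th cell is cut out of `Ω` by the inequalities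
`c k * lor x (p k) ≤ c i * lor x (p i)`, which are linear in `x`. If only `h j` moves, `j ≠ i`, all
of these but one stay fixed (`cellExcept`), and the `i`-th cell is the part of a fixed compact
convex set behind one moving geodesic (`cellArea_update`), the bisector of the `i`-th and `j`-th
circles.

Let `u` be the unit tangent at `q` of the line through `p i` and `p j`, and `n` its normal. In Fermi
coordinates `(y, s)` along this line the area element is `cosh s ds dy`
(`Frame.hypArea_eq`), and the moving bisector is a coordinate line `y = const`, because both
`lor x (p i)` and `lor x (p j)` are `cosh s` times a function of `y`. By Fubini the area is
an integral of slice lengths `l y`, and the fundamental theorem of calculus gives the derivative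
`l 0 = ∫ cosh s ds` over the common edge, that is `sinh dk + sinh dl`
(`Frame.hasDerivAt_hypArea`); the speed of the bisector along the line is
`-1 / (tanh γi + tanh γj)`.

The point that needs the hypotheses is the continuity of `l` at zero: relative interior points of
the edge have to be interior points of the fixed convex set
(`eventually_fermi_mem_cellExcept`). By non-degeneracy `Ω` has points on both sides of the
bisector, so by convexity the edge does not run along the boundary of `Ω`. A third cell that touches
the relative interior of the edge would have to share its bisector line with both other cells, and
of three such cells the middle one has area zero (`weighted_not_collinear`).

If the edge is empty, the cell area is locally constant by compactness. The symmetry of the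
off-diagonal derivatives is visible from the formula, and the diagonal derivatives come from the
fact that the cells tile `Ω` up to null sets (`sum_hypArea_cell`).
-/

namespace HypPower

open MeasureTheory Real Set Filter Topology

/-! ### Minkowski space, geodesics and orthonormal frames -/

theorem lor_comm (x y : Mink) : lor x y = lor y x := by simp only [lor]; ring

theorem lor_add_left (x y z : Mink) : lor (x + y) z = lor x z + lor y z := by
  simp only [lor, Pi.add_apply]; ring

theorem lor_smul_left (a : ℝ) (x z : Mink) : lor (a • x) z = a * lor x z := by
  simp only [lor, Pi.smul_apply, smul_eq_mul]; ring

theorem lor_sub_left (x y z : Mink) : lor (x - y) z = lor x z - lor y z := by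
  simp only [lor, Pi.sub_apply]; ring

theorem lor_add_right (x y z : Mink) : lor z (x + y) = lor z x + lor z y := by
  simp only [lor, Pi.add_apply]; ring

theorem lor_smul_right (a : ℝ) (x z : Mink) : lor z (a • x) = a * lor z x := by
  simp only [lor, Pi.smul_apply, smul_eq_mul]; ring

theorem lor_sub_right (x y z : Mink) : lor z (x - y) = lor z x - lor z y := by
  simp only [lor, Pi.sub_apply]; ring

theorem continuous_lor_right (a : Mink) : Continuous fun x : Mink => lor x a := by
  unfold lor; fun_prop

/-- Reversed Cauchy–Schwarz inequality on the hyperboloid. -/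
theorem one_le_neg_lor {x y : Mink} (hx : x ∈ hypPlane) (hy : y ∈ hypPlane) : 1 ≤ -lor x y := by
  obtain ⟨hx1, hx2⟩ := hx
  obtain ⟨hy1, hy2⟩ := hy
  simp only [lor] at *
  by_contra hlt
  push Not at hlt
  have h1 : x 2 * y 2 < 1 + (x 0 * y 0 + x 1 * y 1) := by linarith
  have h2 : (x 2 * y 2) ^ 2 < (1 + (x 0 * y 0 + x 1 * y 1)) ^ 2 :=
    pow_lt_pow_left₀ h1 (by positivity) (by norm_num)
  have h3 : (x 2 * y 2) ^ 2
      = (1 + x 0 * x 0 + x 1 * x 1) * (1 + y 0 * y 0 + y 1 * y 1) := by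
    have e1 : x 2 * x 2 = 1 + x 0 * x 0 + x 1 * x 1 := by linarith
    have e2 : y 2 * y 2 = 1 + y 0 * y 0 + y 1 * y 1 := by linarith
    rw [← e1, ← e2]; ring
  nlinarith [sq_nonneg (x 0 - y 0), sq_nonneg (x 1 - y 1), sq_nonneg (x 0 * y 1 - x 1 * y 0)]

/-- Equality case of the reversed Cauchy–Schwarz inequality. -/
theorem eq_of_lor_eq_neg_one {x y : Mink} (hx : x ∈ hypPlane) (hy : y ∈ hypPlane)
    (h : lor x y = -1) : x = y := by
  obtain ⟨hx1, hx2⟩ := hx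
  obtain ⟨hy1, hy2⟩ := hy
  simp only [lor] at *
  have h3 : (1 + (x 0 * y 0 + x 1 * y 1)) ^ 2
      = (1 + x 0 * x 0 + x 1 * x 1) * (1 + y 0 * y 0 + y 1 * y 1) := by
    have e1 : 1 + x 0 * x 0 + x 1 * x 1 = x 2 * x 2 := by linarith
    have e2 : 1 + y 0 * y 0 + y 1 * y 1 = y 2 * y 2 := by linarith
    have e3 : 1 + (x 0 * y 0 + x 1 * y 1) = x 2 * y 2 := by linarith
    rw [e1, e2, e3]; ring
  have h4 : (x 0 - y 0) ^ 2 + (x 1 - y 1) ^ 2 + (x 0 * y 1 - x 1 * y 0) ^ 2 = 0 := by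
    linear_combination -h3
  have a0 : x 0 = y 0 := by
    nlinarith [sq_nonneg (x 0 - y 0), sq_nonneg (x 1 - y 1), sq_nonneg (x 0 * y 1 - x 1 * y 0)]
  have a1 : x 1 = y 1 := by
    nlinarith [sq_nonneg (x 0 - y 0), sq_nonneg (x 1 - y 1), sq_nonneg (x 0 * y 1 - x 1 * y 0)]
  have a2 : x 2 = y 2 := by
    rw [a0, a1] at hx1
    have : x 2 ^ 2 = y 2 ^ 2 := by linarith
    exact (pow_left_inj₀ hx2.le hy2.le two_ne_zero).1 this
  ext i; fin_cases i <;> assumption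

theorem lor_geo_left (x v y : Mink) (s : ℝ) :
    lor (geo x v s) y = cosh s * lor x y + sinh s * lor v y := by
  simp only [geo, lor_add_left, lor_smul_left]

theorem geo_mem {x v : Mink} (hx : x ∈ hypPlane) (hv : UnitTangent x v) (s : ℝ) :
    geo x v s ∈ hypPlane := by
  obtain ⟨hx1, hx2⟩ := hx
  obtain ⟨hv1, hv2⟩ := hv
  have hcs := cosh_sq s
  refine ⟨?_, ?_⟩
  · rw [lor_geo_left, lor_comm x, lor_comm v, lor_geo_left, lor_geo_left, hx1, hv1,
      lor_comm v x, hv1, hv2]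
    linear_combination -hcs
  · simp only [lor] at *
    -- the time component of `v` is smaller than that of `x`
    have h1 : (x 0 * v 0 + x 1 * v 1) ^ 2 = (x 2 * v 2) ^ 2 := by
      rw [show x 0 * v 0 + x 1 * v 1 = x 2 * v 2 by linarith]
    have e1 : x 2 * x 2 = 1 + x 0 * x 0 + x 1 * x 1 := by linarith
    have e2 : v 2 * v 2 = v 0 * v 0 + v 1 * v 1 - 1 := by linarith
    have h2 : v 2 ^ 2 < x 2 ^ 2 := by
      nlinarith [sq_nonneg (x 0 * v 1 - x 1 * v 0)]
    have h3 : |v 2| < x 2 := abs_lt_of_sq_lt_sq h2 hx2.le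
    have h4 : |sinh s| < cosh s := abs_lt_of_sq_lt_sq (by linarith) (cosh_pos s).le
    have h5 : |sinh s * v 2| < cosh s * x 2 := by
      rw [abs_mul]
      exact mul_lt_mul'' h4 h3 (abs_nonneg _) (abs_nonneg _)
    have := (abs_lt.1 h5).1
    simp only [geo, Pi.add_apply, Pi.smul_apply, smul_eq_mul]
    linarith

/-- The velocity of the geodesic `geo x v` at time `s`. -/
noncomputable def vel (x v : Mink) (s : ℝ) : Mink := sinh s • x + cosh s • v

theorem unitTangent_vel {x v : Mink} (hx : x ∈ hypPlane) (hv : UnitTangent x v) (s : ℝ) :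
    UnitTangent (geo x v s) (vel x v s) := by
  obtain ⟨hx1, hx2⟩ := hx
  obtain ⟨hv1, hv2⟩ := hv
  have hcs := cosh_sq s
  have hv1' : lor v x = 0 := by rw [lor_comm]; exact hv1
  constructor
  · simp only [geo, vel, lor_add_left, lor_add_right, lor_smul_left, lor_smul_right, hx1, hv1, hv2,
      hv1']
    ring
  · simp only [vel, lor_add_left, lor_add_right, lor_smul_left, lor_smul_right, hx1, hv1, hv2,
      hv1']
    linear_combination hcs

theorem geo_geo (x v : Mink) (s t : ℝ) : geo (geo x v s) (vel x v s) t = geo x v (s + t) := by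
  ext i
  simp only [geo, vel, Pi.add_apply, Pi.smul_apply, smul_eq_mul, cosh_add, sinh_add]
  ring

theorem geo_zero (x v : Mink) : geo x v 0 = x := by simp [geo]

/-- Two distinct points of the hyperbolic plane are joined by a unit-speed geodesic. -/
theorem exists_geo_eq {x y : Mink} (hx : x ∈ hypPlane) (hy : y ∈ hypPlane) (hxy : x ≠ y) :
    ∃ v d, UnitTangent x v ∧ 0 < d ∧ y = geo x v d := by
  have h1 := one_le_neg_lor hx hy
  have h2 : 1 < -lor x y :=
    lt_of_le_of_ne h1 fun h => hxy (eq_of_lor_eq_neg_one hx hy (by linarith))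
  set C := -lor x y with hC
  have hC' : lor x y = -C := by linarith
  have hC'' : lor y x = -C := by rw [lor_comm]; exact hC'
  set S := √(C ^ 2 - 1) with hS
  have hpos : 0 < C ^ 2 - 1 := by nlinarith
  have hS0 : 0 < S := Real.sqrt_pos.2 hpos
  have hS2 : S ^ 2 = C ^ 2 - 1 := Real.sq_sqrt hpos.le
  refine ⟨S⁻¹ • (y - C • x), arcosh C, ⟨?_, ?_⟩, arcosh_pos h2, ?_⟩
  · simp only [lor_smul_right, lor_sub_right, hC', hx.1]; ring
  · simp only [lor_smul_right, lor_sub_right, lor_smul_left, lor_sub_left, hC', hC'', hx.1, hy.1]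
    field_simp
    linear_combination -hS2
  · rw [geo, cosh_arcosh h1, sinh_arcosh h1, ← hS, smul_smul, mul_inv_cancel₀ hS0.ne']
    simp

/-- A Lorentz-orthonormal basis of Minkowski space, with first vector a point of the hyperbolic
plane. -/
structure Frame (q u n : Mink) : Prop where
  mem : q ∈ hypPlane
  tangent : UnitTangent q u
  normal : UnitTangent q n
  orth : lor u n = 0

namespace Frame

variable {q u n : Mink}

/-- The columns of the matrix of an orthonormal frame are orthonormal because the rows are. -/
theorem dual (F : Frame q u n) (i k : Fin 3) :
    -(q i * q k) + u i * u k + n i * n k = Matrix.diagonal ![1, 1, -1] i k := by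
  obtain ⟨⟨hq, -⟩, ⟨hqu, huu⟩, ⟨hqn, hnn⟩, hun⟩ := F
  let M : Matrix (Fin 3) (Fin 3) ℝ := Matrix.of ![q, u, n]
  let J : Matrix (Fin 3) (Fin 3) ℝ := Matrix.diagonal ![1, 1, -1]
  let J' : Matrix (Fin 3) (Fin 3) ℝ := Matrix.diagonal ![-1, 1, 1]
  have h1 : M * (J * M.transpose * J') = 1 := by
    simp only [lor] at *
    ext a b
    fin_cases a <;> fin_cases b <;>
      simp [M, J, J', Matrix.mul_apply, Fin.sum_univ_three, Matrix.diagonal] <;> linarith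
  have h2 := mul_eq_one_comm.1 h1
  have h3 := congrFun (congrFun h2 i) k
  revert h3
  fin_cases i <;> fin_cases k <;>
    simp [M, J, J', Matrix.mul_apply, Fin.sum_univ_three, Matrix.diagonal] <;> intro h3 <;>
      linarith

theorem expand (F : Frame q u n) (x : Mink) :
    x = (-lor x q) • q + lor x u • u + lor x n • n := by
  have d := F.dual
  have d00 := d 0 0
  have d01 := d 0 1
  have d02 := d 0 2
  have d11 := d 1 1
  have d12 := d 1 2
  have d22 := d 2 2
  simp [Matrix.diagonal] at d00 d01 d02 d11 d12 d22
  ext i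
  fin_cases i <;> simp only [lor, Pi.add_apply, Pi.smul_apply, smul_eq_mul, Fin.zero_eta,
    Fin.mk_one, Fin.reduceFinMk]
  · linear_combination -(x 0) * d00 - x 1 * d01 + x 2 * d02
  · linear_combination -(x 0) * d01 - x 1 * d11 + x 2 * d12
  · linear_combination -(x 0) * d02 - x 1 * d12 + x 2 * d22

/-- The minor of the frame that gives the Jacobian of Fermi coordinates in the chart. -/
theorem abs_minor (F : Frame q u n) : |u 0 * n 1 - u 1 * n 0| = q 2 := by
  have d := F.dual
  have d00 := d 0 0
  have d01 := d 0 1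
  have d11 := d 1 1
  simp [Matrix.diagonal] at d00 d01 d11
  have hq := F.mem.1
  simp only [lor] at hq
  rw [← abs_of_pos F.mem.2, ← sq_eq_sq_iff_abs_eq_abs]
  have e0 : u 0 ^ 2 + n 0 ^ 2 = 1 + q 0 ^ 2 := by linarith
  have e1 : u 1 ^ 2 + n 1 ^ 2 = 1 + q 1 ^ 2 := by linarith
  have e2 : u 0 * u 1 + n 0 * n 1 = q 0 * q 1 := by linarith
  calc (u 0 * n 1 - u 1 * n 0) ^ 2
      = (u 0 ^ 2 + n 0 ^ 2) * (u 1 ^ 2 + n 1 ^ 2) - (u 0 * u 1 + n 0 * n 1) ^ 2 := by ring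
    _ = q 2 ^ 2 := by rw [e0, e1, e2]; linarith

theorem neg (F : Frame q u n) : Frame q (-u) n := by
  obtain ⟨hq, ⟨hqu, huu⟩, hn, hun⟩ := F
  refine ⟨hq, ⟨?_, ?_⟩, hn, ?_⟩ <;> simp only [lor, Pi.neg_apply] at * <;> linarith

theorem lor_q_q (F : Frame q u n) : lor q q = -1 := F.mem.1
theorem lor_q_u (F : Frame q u n) : lor q u = 0 := F.tangent.1
theorem lor_q_n (F : Frame q u n) : lor q n = 0 := F.normal.1
theorem lor_u_u (F : Frame q u n) : lor u u = 1 := F.tangent.2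
theorem lor_n_n (F : Frame q u n) : lor n n = 1 := F.normal.2
theorem lor_u_n (F : Frame q u n) : lor u n = 0 := F.orth
theorem lor_u_q (F : Frame q u n) : lor u q = 0 := by rw [lor_comm]; exact F.lor_q_u
theorem lor_n_q (F : Frame q u n) : lor n q = 0 := by rw [lor_comm]; exact F.lor_q_n
theorem lor_n_u (F : Frame q u n) : lor n u = 0 := by rw [lor_comm]; exact F.lor_u_n

theorem unitTangent_geo (F : Frame q u n) (y : ℝ) : UnitTangent (geo q u y) n :=
  ⟨by rw [lor_geo_left, F.lor_q_n, F.lor_u_n]; ring, F.lor_n_n⟩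

/-- The frame transported along a Fermi coordinate line. -/
theorem transport (F : Frame q u n) (y s : ℝ) :
    Frame (geo (geo q u y) n s) (vel q u y) (vel (geo q u y) n s) := by
  have h1 := geo_mem F.mem F.tangent y
  have h2 := F.unitTangent_geo y
  have h3 := unitTangent_vel F.mem F.tangent y
  have h4 : lor n (vel q u y) = 0 := by
    simp only [vel, lor_add_right, lor_smul_right, F.lor_n_q, F.lor_n_u]; ring
  refine ⟨geo_mem h1 h2 s, ⟨?_, h3.2⟩, unitTangent_vel h1 h2 s, ?_⟩
  · rw [lor_geo_left, h3.1, h4]; ring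
  · rw [lor_comm]
    simp only [vel, lor_add_left, lor_smul_left] at *
    rw [h3.1, h4]; ring

end Frame

/-- A unit normal at `q` to the line with direction `u`: the Lorentzian cross product. -/
theorem exists_frame {q u : Mink} (hq : q ∈ hypPlane) (hu : UnitTangent q u) :
    ∃ n, Frame q u n := by
  obtain ⟨hqu, huu⟩ := hu
  have hqq := hq.1
  refine ⟨![q 1 * u 2 - q 2 * u 1, q 2 * u 0 - q 0 * u 2, -(q 0 * u 1 - q 1 * u 0)], hq,
    ⟨hqu, huu⟩, ⟨?_, ?_⟩, ?_⟩ <;> simp [lor] at *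
  · ring
  · linear_combination -(q 0 * q 0 + q 1 * q 1 - q 2 * q 2) * huu - hqq +
      (q 0 * u 0 + q 1 * u 1 - q 2 * u 2) * hqu
  · ring

/-! ### The area measure in Fermi coordinates -/

/-- Fermi coordinates along the geodesic `geo q u`: the point `fermi q u n (y, s)` lies at signed
distance `s` from that geodesic, with foot point at arc length `y`. -/
noncomputable def fermi (q u n : Mink) (z : ℝ × ℝ) : Mink := geo (geo q u z.1) n z.2

theorem fermi_apply (q u n : Mink) (z : ℝ × ℝ) (i : Fin 3) :
    fermi q u n z i = cosh z.2 * (cosh z.1 * q i + sinh z.1 * u i) + sinh z.2 * n i := by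
  simp only [fermi, geo, Pi.add_apply, Pi.smul_apply, smul_eq_mul]

theorem continuous_fermi (q u n : Mink) : Continuous (fermi q u n) := by
  unfold fermi geo; fun_prop

theorem chart_of_mem {x : Mink} (hx : x ∈ hypPlane) : chart (x 0, x 1) = x := by
  obtain ⟨h1, h2⟩ := hx
  simp only [lor] at h1
  have : √(1 + x 0 ^ 2 + x 1 ^ 2) = x 2 := by
    rw [show 1 + x 0 ^ 2 + x 1 ^ 2 = x 2 ^ 2 by linarith, Real.sqrt_sq h2.le]
  ext i; fin_cases i <;> simp [chart, this]

theorem chart_mem (z : ℝ × ℝ) : chart z ∈ hypPlane := by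
  have h : (0 : ℝ) < 1 + z.1 ^ 2 + z.2 ^ 2 := by positivity
  refine ⟨?_, by simpa [chart] using h⟩
  have := Real.mul_self_sqrt h.le
  simp [lor, chart]; linarith

namespace Frame

variable {q u n : Mink}

theorem fermi_mem (F : Frame q u n) (z : ℝ × ℝ) : fermi q u n z ∈ hypPlane :=
  geo_mem (geo_mem F.mem F.tangent _) (F.unitTangent_geo _) _

theorem lor_fermi_q (F : Frame q u n) (z : ℝ × ℝ) :
    lor (fermi q u n z) q = -(cosh z.2 * cosh z.1) := by
  rw [fermi, lor_geo_left, lor_geo_left, F.lor_q_q, F.lor_u_q, F.lor_n_q]; ring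

theorem lor_fermi_u (F : Frame q u n) (z : ℝ × ℝ) :
    lor (fermi q u n z) u = cosh z.2 * sinh z.1 := by
  rw [fermi, lor_geo_left, lor_geo_left, F.lor_q_u, F.lor_u_u, F.lor_n_u]; ring

theorem lor_fermi_n (F : Frame q u n) (z : ℝ × ℝ) :
    lor (fermi q u n z) n = sinh z.2 := by
  rw [fermi, lor_geo_left, lor_geo_left, F.lor_q_n, F.lor_u_n, F.lor_n_n]; ring

theorem fermi_injective (F : Frame q u n) : Function.Injective (fermi q u n) := by
  intro z w h
  have h2 : z.2 = w.2 := sinh_injective (by rw [← F.lor_fermi_n, h, F.lor_fermi_n])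
  have h1 : cosh z.2 * sinh z.1 = cosh w.2 * sinh w.1 := by
    rw [← F.lor_fermi_u, h, F.lor_fermi_u]
  rw [h2] at h1
  exact Prod.ext (sinh_injective (mul_left_cancel₀ (cosh_pos _).ne' h1)) h2

theorem exists_fermi_eq (F : Frame q u n) {x : Mink} (hx : x ∈ hypPlane) :
    ∃ z, fermi q u n z = x := by
  set s := arsinh (lor x n)
  set y := arsinh (lor x u / cosh s)
  have hs : sinh s = lor x n := sinh_arsinh _
  have hy : cosh s * sinh y = lor x u := by
    rw [sinh_arsinh]; field_simp
  have hq : cosh s * cosh y = -lor x q := by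
    have hpos := one_le_neg_lor hx F.mem
    have hself : lor x x = -1 := hx.1
    rw [F.expand x] at hself
    simp only [lor_add_left, lor_smul_left, lor_add_right, lor_smul_right, F.lor_q_q, F.lor_q_u,
      F.lor_q_n, F.lor_u_q, F.lor_u_u, F.lor_u_n, F.lor_n_q, F.lor_n_u, F.lor_n_n] at hself
    have h2 : (cosh s * cosh y) ^ 2 = (-lor x q) ^ 2 := by
      have e1 := cosh_sq s
      have e2 := cosh_sq y
      rw [← hs, ← hy] at hself
      rw [mul_pow, e2]
      linear_combination e1 + hself
    exact (pow_left_inj₀ (by positivity) (by linarith) two_ne_zero).1 h2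
  refine ⟨(y, s), ?_⟩
  ext i
  rw [fermi_apply, F.expand x]
  simp only [Pi.add_apply, Pi.smul_apply, smul_eq_mul]
  rw [← hs, ← hy, ← hq]; ring

/-- The derivative of Fermi coordinates, read in the chart. -/
theorem hasFDerivAt_fermi (z : ℝ × ℝ) :
    HasFDerivAt (fun z => (fermi q u n z 0, fermi q u n z 1))
      (LinearMap.toContinuousLinearMap (Matrix.toLin (Module.Basis.finTwoProd ℝ)
        (Module.Basis.finTwoProd ℝ)
        !![cosh z.2 * vel q u z.1 0, vel (geo q u z.1) n z.2 0;
          cosh z.2 * vel q u z.1 1, vel (geo q u z.1) n z.2 1])) z := by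
  rw [Matrix.toLin_finTwoProd_toContinuousLinearMap]
  have key : ∀ i, HasFDerivAt (fun z => fermi q u n z i)
      ((cosh z.2 * vel q u z.1 i) • ContinuousLinearMap.fst ℝ ℝ ℝ +
        (vel (geo q u z.1) n z.2 i) • ContinuousLinearMap.snd ℝ ℝ ℝ) z := by
    intro i
    simp only [fermi_apply]
    have c1 := (hasDerivAt_cosh z.1).comp_hasFDerivAt z (hasFDerivAt_fst (𝕜 := ℝ))
    have s1 := (hasDerivAt_sinh z.1).comp_hasFDerivAt z (hasFDerivAt_fst (𝕜 := ℝ))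
    have c2 := (hasDerivAt_cosh z.2).comp_hasFDerivAt z (hasFDerivAt_snd (𝕜 := ℝ))
    have s2 := (hasDerivAt_sinh z.2).comp_hasFDerivAt z (hasFDerivAt_snd (𝕜 := ℝ))
    have := (c2.mul ((c1.mul_const (q i)).add (s1.mul_const (u i)))).add (s2.mul_const (n i))
    refine this.congr_fderiv ?_
    ext <;> simp [vel, geo] <;> ring
  exact (key 0).prodMk (key 1)

/-- The area element in Fermi coordinates is `cosh s ds dy`. -/
theorem hypArea_eq (F : Frame q u n) {A : Set Mink} (hA : MeasurableSet A) :
    hypArea A = ∫⁻ z in fermi q u n ⁻¹' A, ENNReal.ofReal (cosh z.2) := by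
  have hchart : ∀ z, chart (fermi q u n z 0, fermi q u n z 1) = fermi q u n z :=
    fun z => chart_of_mem (F.fermi_mem z)
  have himage : (fun z => (fermi q u n z 0, fermi q u n z 1)) '' univ = univ := by
    refine eq_univ_of_forall fun w => ?_
    obtain ⟨z, hz⟩ := F.exists_fermi_eq (chart_mem w)
    exact ⟨z, mem_univ z, by simp [hz, chart]⟩
  have hinj : InjOn (fun z => (fermi q u n z 0, fermi q u n z 1)) univ := by
    intro z _ w _ h
    apply F.fermi_injective
    rw [← hchart z, ← hchart w]
    exact congrArg chart h
  rw [hypArea, Measure.map_apply measurable_chart hA,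
    withDensity_apply _ (measurable_chart hA),
    ← lintegral_indicator (measurable_chart hA), ← setLIntegral_univ, ← himage,
    lintegral_image_eq_lintegral_abs_det_fderiv_mul volume MeasurableSet.univ
      (fun z _ => (hasFDerivAt_fermi (q := q) (u := u) (n := n) z).hasFDerivWithinAt) hinj,
    setLIntegral_univ,
    ← lintegral_indicator ((continuous_fermi q u n).measurable hA)]
  refine lintegral_congr fun z => ?_
  have h2 := (F.fermi_mem z).2
  have hdet : |cosh z.2 * vel q u z.1 0 * vel (geo q u z.1) n z.2 1 -
      vel (geo q u z.1) n z.2 0 * (cosh z.2 * vel q u z.1 1)| = cosh z.2 * fermi q u n z 2 := by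
    have := (F.transport z.1 z.2).abs_minor
    rw [fermi, ← this, ← abs_of_pos (cosh_pos z.2), ← abs_mul, abs_of_pos (cosh_pos z.2)]
    congr 1; ring
  have hmem : (fermi q u n z 0, fermi q u n z 1) ∈ chart ⁻¹' A ↔ z ∈ fermi q u n ⁻¹' A := by
    rw [mem_preimage, hchart, mem_preimage]
  have hsqrt : √(1 + fermi q u n z 0 ^ 2 + fermi q u n z 1 ^ 2) = fermi q u n z 2 := by
    have := congrFun (hchart z) 2
    simpa [chart] using this
  rw [LinearMap.det_toContinuousLinearMap, LinearMap.det_toLin, Matrix.det_fin_two_of, hdet]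
  by_cases hz : z ∈ fermi q u n ⁻¹' A
  · rw [indicator_of_mem (hmem.2 hz), indicator_of_mem hz, hsqrt,
      ← ENNReal.ofReal_mul (by positivity)]
    congr 1; field_simp
  · rw [indicator_of_notMem (mt hmem.1 hz), indicator_of_notMem hz, mul_zero]

/-- A geodesic has area zero. -/
theorem hypArea_line (F : Frame q u n) : hypArea {x | x ∈ hypPlane ∧ lor x u = 0} = 0 := by
  have hm : MeasurableSet {x | x ∈ hypPlane ∧ lor x u = 0} := by
    have h0 : Measurable fun x : Mink => lor x x := by unfold lor; fun_prop
    have h1 := (continuous_lor_right u).measurable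
    have h2 : Measurable fun x : Mink => x 2 := by fun_prop
    exact ((measurableSet_eq_fun h0 measurable_const).inter
      (measurableSet_lt measurable_const h2)).inter (measurableSet_eq_fun h1 measurable_const)
  rw [F.hypArea_eq hm]
  have : fermi q u n ⁻¹' {x | x ∈ hypPlane ∧ lor x u = 0} ⊆ {0} ×ˢ univ := by
    intro z hz
    have := hz.2
    rw [F.lor_fermi_u] at this
    have h0 : sinh z.1 = 0 := (mul_eq_zero.1 this).resolve_left (cosh_pos _).ne'
    simpa using h0
  refine setLIntegral_measure_zero _ _ (measure_mono_null this ?_)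
  rw [Measure.volume_eq_prod, Measure.prod_prod]; simp

end Frame

/-! ### The area behind a moving geodesic -/

theorem hasDerivAt_artanh_zero : HasDerivAt artanh 1 0 := by
  have h1 : HasDerivAt (fun x : ℝ => √(1 - x ^ 2)) 0 0 := by
    have h : HasDerivAt (fun x : ℝ => 1 - x ^ 2) 0 0 := by
      simpa using ((hasDerivAt_id (0 : ℝ)).pow 2).const_sub 1
    simpa using h.sqrt (by norm_num)
  have h2 : HasDerivAt (fun x : ℝ => x / √(1 - x ^ 2)) 1 0 := by
    have h := (hasDerivAt_id' (0 : ℝ)).fun_div h1 (by norm_num)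
    simpa using h
  have h3 : HasDerivAt (fun x : ℝ => arsinh (x / √(1 - x ^ 2))) 1 0 := by
    simpa using h2.arsinh
  refine h3.congr_of_eventuallyEq ?_
  filter_upwards [Ioo_mem_nhds (show (-1 : ℝ) < 0 by norm_num) (show (0 : ℝ) < 1 by norm_num)]
    with x hx
  rw [← sinh_artanh hx, arsinh_sinh]

theorem sinh_le_mul_cosh_iff {T : ℝ} (hT : T ∈ Ioo (-1 : ℝ) 1) (y : ℝ) :
    sinh y ≤ T * cosh y ↔ y ≤ artanh T := by
  have h1 := tanh_artanh hT
  rw [tanh_eq_sinh_div_cosh] at h1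
  have hc := cosh_pos (artanh T)
  rw [div_eq_iff hc.ne'] at h1
  have h2 : sinh (y - artanh T) = cosh (artanh T) • (sinh y - T * cosh y) := by
    rw [sinh_sub, h1, smul_eq_mul]; ring
  rw [← sub_nonpos, ← sub_nonpos (a := y), ← sinh_nonpos_iff (x := y - artanh T), h2,
    smul_nonpos_iff_nonpos_of_pos_left hc]

namespace Frame

variable {q u n : Mink}

theorem isCompact_preimage_fermi (F : Frame q u n) {K : Set Mink} (hK : IsCompact K) :
    IsCompact (fermi q u n ⁻¹' K) := by
  obtain ⟨R, hR⟩ := hK.exists_bound_of_continuousOn (continuous_lor_right u).continuousOn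
  obtain ⟨S, hS⟩ := hK.exists_bound_of_continuousOn (continuous_lor_right n).continuousOn
  have hbox : IsCompact (Icc (-arsinh R) (arsinh R) ×ˢ Icc (-arsinh S) (arsinh S)) :=
    isCompact_Icc.prod isCompact_Icc
  refine hbox.of_isClosed_subset (hK.isClosed.preimage (continuous_fermi q u n)) fun z hz => ?_
  have h1 := hR _ hz
  have h2 := hS _ hz
  rw [Real.norm_eq_abs] at h1 h2
  rw [F.lor_fermi_u, abs_mul, abs_of_pos (cosh_pos _)] at h1
  rw [F.lor_fermi_n] at h2
  have h3 : |sinh z.1| ≤ R :=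
    (le_mul_of_one_le_left (abs_nonneg _) (one_le_cosh z.2)).trans h1
  rw [abs_le] at h2 h3
  simp only [mem_prod, mem_Icc, ← arsinh_neg]
  refine ⟨⟨?_, ?_⟩, ?_, ?_⟩ <;> rw [← sinh_le_sinh, sinh_arsinh] <;> tauto

/-- The area of the part of a compact set behind a moving geodesic perpendicular to the geodesic
`geo q u`. The derivative is the integral of the speed `cosh s` over the segment `Icc a b` that the
set cuts out of the geodesic at time zero, provided that this segment is not part of the boundary
of the set. -/
theorem hasDerivAt_hypArea (F : Frame q u n) {K : Set Mink} (hK : IsCompact K) {a b : ℝ}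
    (hab : a ≤ b) (hseg : ∀ s, fermi q u n (0, s) ∈ K → s ∈ Icc a b)
    (hint : ∀ s ∈ Ioo a b, ∀ᶠ y in 𝓝 (0 : ℝ), fermi q u n (y, s) ∈ K) :
    HasDerivAt (fun T => (hypArea (K ∩ {x | lor x u + T * lor x q ≤ 0})).toReal)
      (sinh b - sinh a) 0 := by
  set C := fermi q u n ⁻¹' K with hCdef
  have hC : IsCompact C := F.isCompact_preimage_fermi hK
  have hCm : MeasurableSet C := hC.isClosed.measurableSet
  set φ : ℝ × ℝ → ℝ := C.indicator fun z => cosh z.2 with hφ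
  have hcont : Continuous fun z : ℝ × ℝ => cosh z.2 := by fun_prop
  have hφint : Integrable φ (volume.prod volume) := by
    rw [← Measure.volume_eq_prod]
    exact (integrable_indicator_iff hCm).2 (hcont.continuousOn.integrableOn_compact hC)
  set l : ℝ → ℝ := fun y => ∫ s, φ (y, s) with hl
  have hlint : Integrable l := hφint.integral_prod_left
  -- the area as an integral of slice lengths
  have harea : ∀ T ∈ Ioo (-1 : ℝ) 1,
      (hypArea (K ∩ {x | lor x u + T * lor x q ≤ 0})).toReal = ∫ y in Iic (artanh T), l y := by
    intro T hT
    have hclosed : IsClosed {x : Mink | lor x u + T * lor x q ≤ 0} :=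
      isClosed_le ((continuous_lor_right u).add (continuous_const.mul (continuous_lor_right q)))
        continuous_const
    have hm : MeasurableSet (K ∩ {x | lor x u + T * lor x q ≤ 0}) :=
      hK.isClosed.measurableSet.inter hclosed.measurableSet
    have hpre : fermi q u n ⁻¹' (K ∩ {x | lor x u + T * lor x q ≤ 0}) =
        C ∩ (Iic (artanh T) ×ˢ univ) := by
      ext z
      simp only [mem_preimage, mem_inter_iff, mem_ofPred_eq, mem_prod, mem_Iic, mem_univ, and_true,
        hCdef, and_congr_right_iff]
      intro _
      rw [F.lor_fermi_u, F.lor_fermi_q, ← sinh_le_mul_cosh_iff hT]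
      have hc := cosh_pos z.2
      rw [show cosh z.2 * sinh z.1 + T * -(cosh z.2 * cosh z.1)
        = cosh z.2 • (sinh z.1 - T * cosh z.1) by rw [smul_eq_mul]; ring,
        smul_nonpos_iff_nonpos_of_pos_left hc, sub_nonpos]
    rw [F.hypArea_eq hm, hpre, ← integral_eq_lintegral_of_nonneg_ae
      (Eventually.of_forall fun z => (cosh_pos _).le) hcont.aestronglyMeasurable, inter_comm,
      ← setIntegral_indicator hCm, Measure.volume_eq_prod, setIntegral_prod _ hφint.integrableOn]
    simp only [setIntegral_univ, hl, hφ]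
  -- continuity of the slice length at zero
  obtain ⟨S, hS⟩ : ∃ S, ∀ z ∈ C, |z.2| ≤ S := by
    simpa using hC.exists_bound_of_continuousOn (f := Prod.snd) continuous_snd.continuousOn
  have hlcont : ContinuousAt l 0 := by
    refine continuousAt_of_dominated (bound := (Icc (-S) S).indicator fun s => cosh s) ?_ ?_ ?_ ?_
    · refine Eventually.of_forall fun y => ?_
      have h : Measurable fun s => φ (y, s) :=
        (hcont.measurable.indicator hCm).comp measurable_prodMk_left
      exact h.aestronglyMeasurable
    · refine Eventually.of_forall fun y => Eventually.of_forall fun s => ?_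
      by_cases hz : (y, s) ∈ C
      · have hs : s ∈ Icc (-S) S := abs_le.1 (hS _ hz)
        rw [hφ, indicator_of_mem hz, indicator_of_mem hs, Real.norm_eq_abs, abs_of_pos (cosh_pos _)]
      · rw [hφ, indicator_of_notMem hz, norm_zero]
        exact indicator_nonneg (fun s _ => (cosh_pos s).le) s
    · exact (integrable_indicator_iff measurableSet_Icc).2
        (continuous_cosh.continuousOn.integrableOn_Icc)
    · have hnull : ∀ᵐ s : ℝ, s ∉ ({a, b} : Set ℝ) :=
        (measure_eq_zero_iff_ae_notMem).1 ((Set.toFinite _).measure_zero volume)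
      filter_upwards [hnull] with s hs
      have hcs : Continuous fun y : ℝ => fermi q u n (y, s) :=
        (continuous_fermi q u n).comp (by fun_prop)
      suffices h : (fun y => φ (y, s)) =ᶠ[𝓝 0] fun _ => φ (0, s) from
        h.continuousAt
      by_cases hs0 : s ∈ Ioo a b
      · have h := hint s hs0
        filter_upwards [h] with y hy
        rw [hφ, indicator_of_mem (show (y, s) ∈ C from hy),
          indicator_of_mem (show ((0 : ℝ), s) ∈ C from h.self_of_nhds)]
      · have h0 : fermi q u n (0, s) ∉ K := by
          intro h
          have h1 := hseg s h
          simp only [mem_insert_iff, mem_singleton_iff, not_or] at hs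
          exact hs0 ⟨lt_of_le_of_ne h1.1 (Ne.symm hs.1), lt_of_le_of_ne h1.2 hs.2⟩
        have h := hcs.continuousAt.eventually (hK.isClosed.isOpen_compl.mem_nhds h0)
        filter_upwards [h] with y hy
        rw [hφ, indicator_of_notMem (show (y, s) ∉ C from hy),
          indicator_of_notMem (show ((0 : ℝ), s) ∉ C from h0)]
  have hl0 : l 0 = sinh b - sinh a := by
    have h1 : l 0 = ∫ s in Icc a b, cosh s := by
      rw [hl, ← integral_indicator measurableSet_Icc]
      refine integral_congr_ae ?_
      have hnull : ∀ᵐ s : ℝ, s ∉ ({a, b} : Set ℝ) :=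
        (measure_eq_zero_iff_ae_notMem).1 ((Set.toFinite _).measure_zero volume)
      filter_upwards [hnull] with s hs
      simp only [mem_insert_iff, mem_singleton_iff, not_or] at hs
      by_cases hs0 : s ∈ Icc a b
      · have hs1 : s ∈ Ioo a b := ⟨lt_of_le_of_ne hs0.1 (Ne.symm hs.1), lt_of_le_of_ne hs0.2 hs.2⟩
        rw [indicator_of_mem hs0, hφ, indicator_of_mem]
        exact (hint s hs1).self_of_nhds
      · rw [indicator_of_notMem hs0, hφ, indicator_of_notMem]
        exact fun h => hs0 (hseg s h)
    rw [h1, integral_Icc_eq_integral_Ioc, ← intervalIntegral.integral_of_le hab]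
    exact intervalIntegral.integral_eq_sub_of_hasDerivAt (fun s _ => hasDerivAt_sinh s)
      (continuous_cosh.intervalIntegrable _ _)
  -- the fundamental theorem of calculus
  have hftc : HasDerivAt (fun Y => ∫ y in Iic Y, l y) (sinh b - sinh a) (artanh 0) := by
    rw [artanh_zero]
    have h1 : HasDerivAt (fun Y => ∫ y in (0 : ℝ)..Y, l y) (l 0) 0 :=
      intervalIntegral.integral_hasDerivAt_right hlint.intervalIntegrable
        hlint.aestronglyMeasurable.stronglyMeasurableAtFilter hlcont
    rw [hl0] at h1
    refine (h1.const_add (∫ y in Iic 0, l y)).congr_of_eventuallyEq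
      (Eventually.of_forall fun Y => ?_)
    simp only [← intervalIntegral.integral_Iic_sub_Iic hlint.integrableOn hlint.integrableOn]
    ring
  have hcomp := hftc.comp 0 hasDerivAt_artanh_zero
  rw [mul_one] at hcomp
  refine hcomp.congr_of_eventuallyEq ?_
  filter_upwards [Ioo_mem_nhds (show (-1 : ℝ) < 0 by norm_num) (show (0 : ℝ) < 1 by norm_num)]
    with T hT
  exact harea T hT

end Frame

/-! ### Convexity and Laguerre bisectors -/

/-- A geodesically convex set contains every point of the hyperbolic plane in the cone spanned by
two of its points. -/
theorem GeodesicallyConvex.mem_of_eq_combo {Ω : Set Mink} (hΩ : Ω ⊆ hypPlane)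
    (hconvex : GeodesicallyConvex Ω) {x y z : Mink} (hx : x ∈ Ω) (hy : y ∈ Ω) (hz : z ∈ hypPlane)
    {α β : ℝ} (hα : 0 ≤ α) (hβ : 0 ≤ β) (h : z = α • x + β • y) : z ∈ Ω := by
  have hzz := hz.1
  by_cases hxy : x = y
  · subst hxy
    rw [← add_smul] at h
    rw [h, lor_smul_left, lor_smul_right, (hΩ hx).1] at hzz
    have h1 : α + β = 1 := by nlinarith
    rwa [h, h1, one_smul]
  · obtain ⟨v, d, hv, hd, rfl⟩ := exists_geo_eq (hΩ hx) (hΩ hy) hxy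
    have hvx : lor v x = 0 := by rw [lor_comm]; exact hv.1
    set s := arsinh (β * sinh d)
    have hs : sinh s = β * sinh d := sinh_arsinh _
    have hz' : z = (α + β * cosh d) • x + (β * sinh d) • v := by
      rw [h, geo, smul_add, smul_smul, smul_smul, ← add_assoc, ← add_smul]
    have hc : cosh s = α + β * cosh d := by
      rw [hz', ← hs] at hzz
      simp only [lor_add_left, lor_smul_left, lor_add_right, lor_smul_right, (hΩ hx).1, hv.1, hv.2,
        hvx] at hzz
      have h2 : cosh s ^ 2 = (α + β * cosh d) ^ 2 := by
        rw [cosh_sq]; linear_combination hzz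
      exact (pow_left_inj₀ (by positivity) (by positivity) two_ne_zero).1 h2
    have hgeo : z = geo x v s := by rw [hz', geo, hc, hs]
    have hsd : 0 < sinh d := sinh_pos_iff.2 hd
    rw [hgeo]
    refine hconvex x hx v hv d hd.le hy s ⟨?_, ?_⟩
    · rw [← sinh_nonneg_iff, hs]; positivity
    · rw [← sub_nonneg, ← sinh_nonneg_iff, sinh_sub, hc, hs]
      have : sinh d * (α + β * cosh d) - cosh d * (β * sinh d) = α * sinh d := by ring
      rw [this]; positivity

namespace Frame

variable {q u n : Mink}

/-- If a convex set contains an open segment of the geodesic `geo q n` and a point `a` off this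
geodesic, it contains a neighbourhood of each point of the segment on the side of `a`. -/
theorem eventually_fermi_mem_of_side (F : Frame q u n) {Ω : Set Mink} (hΩ : Ω ⊆ hypPlane)
    (hconvex : GeodesicallyConvex Ω) {s₁ s₂ s : ℝ} (hseg : ∀ t ∈ Ioo s₁ s₂, geo q n t ∈ Ω)
    (hs : s ∈ Ioo s₁ s₂) {a : Mink} (ha : a ∈ Ω) (hau : lor a u ≠ 0) :
    ∀ᶠ y in 𝓝 (0 : ℝ), 0 ≤ y * lor a u → fermi q u n (y, s) ∈ Ω := by
  -- `fermi (y, s) = α y • a + A y • q + B y • n`, where the last two terms stay in the cone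
  -- over the segment for small `y`
  let α : ℝ → ℝ := fun y => cosh s * sinh y / lor a u
  let A : ℝ → ℝ := fun y => cosh s * cosh y + α y * lor a q
  let B : ℝ → ℝ := fun y => sinh s - α y * lor a n
  have hαc : Continuous α := by simp only [α]; fun_prop
  have hAc : Continuous A := by simp only [A]; fun_prop
  have hBc : Continuous B := by simp only [B]; fun_prop
  have e1 : ∀ᶠ y in 𝓝 (0 : ℝ), 0 < A y :=
    hAc.continuousAt.eventually (lt_mem_nhds (by simp [A, α, cosh_pos]))
  have e2 : ∀ᶠ y in 𝓝 (0 : ℝ), 0 < B y * cosh s₁ - A y * sinh s₁ := by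
    refine ((hBc.mul continuous_const).sub (hAc.mul continuous_const)).continuousAt.eventually
      (lt_mem_nhds ?_)
    have : 0 < sinh (s - s₁) := sinh_pos_iff.2 (sub_pos.2 hs.1)
    rw [sinh_sub] at this
    simpa [A, B, α] using this
  have e3 : ∀ᶠ y in 𝓝 (0 : ℝ), 0 < A y * sinh s₂ - B y * cosh s₂ := by
    refine ((hAc.mul continuous_const).sub (hBc.mul continuous_const)).continuousAt.eventually
      (lt_mem_nhds ?_)
    have : 0 < sinh (s₂ - s) := sinh_pos_iff.2 (sub_pos.2 hs.2)
    rw [sinh_sub] at this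
    simp [A, B, α]; linarith
  filter_upwards [e1, e2, e3] with y hA h1 h2 hside
  have hα : 0 ≤ α y := by
    have hy : 0 ≤ sinh y * lor a u := by
      rcases le_total 0 y with hy | hy
      · rcases hy.eq_or_lt with rfl | hy
        · simp
        · exact mul_nonneg (sinh_nonneg_iff.2 hy.le) (nonneg_of_mul_nonneg_right hside hy)
      · rcases hy.eq_or_lt with rfl | hy
        · simp
        · refine mul_nonneg_of_nonpos_of_nonpos (sinh_nonpos_iff.2 hy.le) ?_
          by_contra hlt
          exact absurd hside (not_le.2 (mul_neg_of_neg_of_pos hy (not_le.1 hlt)))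
    have : α y = cosh s * (sinh y * lor a u) / (lor a u) ^ 2 := by
      simp only [α]; field_simp
    rw [this]
    exact div_nonneg (mul_nonneg (cosh_pos s).le hy) (sq_nonneg _)
  have hratio : B y / A y ∈ Ioo (-1 : ℝ) 1 := by
    have c1 := cosh_pos s₁
    have c2 := cosh_pos s₂
    have t1 := neg_one_lt_tanh s₁
    have t2 := tanh_lt_one s₂
    rw [tanh_eq_sinh_div_cosh] at t1 t2
    refine ⟨t1.trans ?_, lt_trans ?_ t2⟩
    · rw [div_lt_div_iff₀ c1 hA]; linarith
    · rw [div_lt_div_iff₀ hA c2]; linarith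
  set t := artanh (B y / A y)
  have ht : sinh t * A y = B y * cosh t := by
    have := tanh_artanh hratio
    rw [tanh_eq_sinh_div_cosh, div_eq_div_iff (cosh_pos _).ne' hA.ne'] at this
    exact this
  have hct := cosh_pos t
  have htmem : t ∈ Ioo s₁ s₂ := by
    constructor
    · rw [← sub_pos, ← sinh_pos_iff, sinh_sub]
      refine pos_of_mul_pos_left (b := A y) ?_ hA.le
      have : (sinh t * cosh s₁ - cosh t * sinh s₁) * A y
        = cosh t * (B y * cosh s₁ - A y * sinh s₁) := by linear_combination cosh s₁ * ht
      rw [this]; positivity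
    · rw [← sub_pos, ← sinh_pos_iff, sinh_sub]
      refine pos_of_mul_pos_left (b := A y) ?_ hA.le
      have : (sinh s₂ * cosh t - cosh s₂ * sinh t) * A y
        = cosh t * (A y * sinh s₂ - B y * cosh s₂) := by linear_combination -cosh s₂ * ht
      rw [this]; positivity
  refine hconvex.mem_of_eq_combo hΩ ha (hseg t htmem) (F.fermi_mem _) hα
    (show 0 ≤ A y / cosh t by positivity) ?_
  have k1 : A y / cosh t * sinh t = B y := by field_simp; linarith
  have k2 : A y / cosh t * cosh t = A y := by field_simp
  have k3 : α y * lor a u = cosh s * sinh y := by simp only [α]; field_simp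
  ext i
  have hexp := congrFun (F.expand a) i
  simp only [Pi.add_apply, Pi.smul_apply, smul_eq_mul] at hexp
  rw [fermi_apply]
  simp only [geo, Pi.add_apply, Pi.smul_apply, smul_eq_mul]
  have kA : A y = cosh s * cosh y + α y * lor a q := rfl
  have kB : B y = sinh s - α y * lor a n := rfl
  linear_combination -(α y) * hexp - q i * k2 - n i * k1 - u i * k3 - q i * kA - n i * kB

theorem eventually_fermi_mem (F : Frame q u n) {Ω : Set Mink} (hΩ : Ω ⊆ hypPlane)
    (hconvex : GeodesicallyConvex Ω) {s₁ s₂ s : ℝ} (hseg : ∀ t ∈ Ioo s₁ s₂, geo q n t ∈ Ω)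
    (hs : s ∈ Ioo s₁ s₂) {a b : Mink} (ha : a ∈ Ω) (hau : 0 < lor a u) (hb : b ∈ Ω)
    (hbu : lor b u < 0) :
    ∀ᶠ y in 𝓝 (0 : ℝ), fermi q u n (y, s) ∈ Ω := by
  filter_upwards [F.eventually_fermi_mem_of_side hΩ hconvex hseg hs ha hau.ne',
    F.eventually_fermi_mem_of_side hΩ hconvex hseg hs hb hbu.ne] with y h1 h2
  rcases le_total 0 y with hy | hy
  · exact h1 (mul_nonneg hy hau.le)
  · exact h2 (mul_nonneg_of_nonpos_of_nonpos hy hbu.le)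

end Frame

theorem pow_eq {x c : Mink} (hx : x ∈ hypPlane) (hc : c ∈ hypPlane) (ρ : ℝ) :
    pow x c ρ = -((cosh ρ)⁻¹ * lor x c) := by
  rw [pow, hdist, cosh_arcosh (one_le_neg_lor hx hc)]
  field_simp

namespace BisectorFrame

variable {a b q u n : Mink} {ρ τ γa γb : ℝ}

theorem frame (B : BisectorFrame a b ρ τ q u n γa γb) : Frame q u n :=
  ⟨B.mem, B.tangent, B.normal, B.orth⟩

theorem left_mem (B : BisectorFrame a b ρ τ q u n γa γb) : a ∈ hypPlane := by
  rw [B.left]; exact geo_mem B.mem B.tangent _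

theorem right_mem (B : BisectorFrame a b ρ τ q u n γa γb) : b ∈ hypPlane := by
  rw [B.right]; exact geo_mem B.mem B.tangent _

theorem lor_left (B : BisectorFrame a b ρ τ q u n γa γb) (x : Mink) :
    lor x a = cosh γa * lor x q - sinh γa * lor x u := by
  rw [B.left, lor_comm, lor_geo_left, lor_comm q, lor_comm u, cosh_neg, sinh_neg]; ring

theorem lor_right (B : BisectorFrame a b ρ τ q u n γa γb) (x : Mink) :
    lor x b = cosh γb * lor x q + sinh γb * lor x u := by
  rw [B.right, lor_comm, lor_geo_left, lor_comm q, lor_comm u]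

theorem cosh_eq (B : BisectorFrame a b ρ τ q u n γa γb) :
    (cosh ρ)⁻¹ * cosh γa = (cosh τ)⁻¹ * cosh γb := by
  have h := B.bisect
  rw [pow_eq B.mem B.left_mem, pow_eq B.mem B.right_mem, B.lor_left, B.lor_right,
    B.frame.lor_q_q, B.frame.lor_q_u] at h
  linarith

theorem tanh_add_pos (B : BisectorFrame a b ρ τ q u n γa γb) : 0 < tanh γa + tanh γb := by
  have h := sinh_pos_iff.2 B.pos
  rw [sinh_add] at h
  have ca := cosh_pos γa
  have cb := cosh_pos γb
  rw [tanh_eq_sinh_div_cosh, tanh_eq_sinh_div_cosh, div_add_div _ _ ca.ne' cb.ne']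
  positivity

theorem sinh_eq (B : BisectorFrame a b ρ τ q u n γa γb) :
    (cosh ρ)⁻¹ * sinh γa + (cosh τ)⁻¹ * sinh γb
      = (cosh τ)⁻¹ * cosh γb * (tanh γa + tanh γb) := by
  have ca := cosh_pos γa
  have cb := cosh_pos γb
  have h1 : sinh γa = cosh γa * tanh γa := by rw [tanh_eq_sinh_div_cosh]; field_simp
  have h2 : sinh γb = cosh γb * tanh γb := by rw [tanh_eq_sinh_div_cosh]; field_simp
  rw [h1, h2]
  linear_combination tanh γa * B.cosh_eq

theorem sinh_pos (B : BisectorFrame a b ρ τ q u n γa γb) :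
    0 < (cosh ρ)⁻¹ * sinh γa + (cosh τ)⁻¹ * sinh γb := by
  rw [B.sinh_eq]
  have := B.tanh_add_pos
  positivity

/-- The difference of the weighted centres is a positive multiple of the normal `u` of the
bisector. -/
theorem weighted_sub (B : BisectorFrame a b ρ τ q u n γa γb) (x : Mink) :
    (cosh τ)⁻¹ * lor x b - (cosh ρ)⁻¹ * lor x a
      = ((cosh ρ)⁻¹ * sinh γa + (cosh τ)⁻¹ * sinh γb) * lor x u := by
  rw [B.lor_left, B.lor_right]
  linear_combination -lor x q * B.cosh_eq

theorem pow_eq_iff (B : BisectorFrame a b ρ τ q u n γa γb) {x : Mink} (hx : x ∈ hypPlane) :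
    pow x a ρ = pow x b τ ↔ lor x u = 0 := by
  rw [pow_eq hx B.left_mem, pow_eq hx B.right_mem, neg_inj, eq_comm, ← sub_eq_zero,
    B.weighted_sub, mul_eq_zero]
  exact or_iff_right B.sinh_pos.ne'

theorem swap (B : BisectorFrame a b ρ τ q u n γa γb) :
    BisectorFrame b a τ ρ q (-u) n γb γa where
  mem := B.mem
  bisect := B.bisect.symm
  tangent := B.frame.neg.tangent
  normal := B.normal
  orth := B.frame.neg.orth
  left := by rw [B.right, geo, geo, cosh_neg, sinh_neg]; simp
  right := by rw [B.left, geo, geo, cosh_neg, sinh_neg]; simp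
  pos := by linarith [B.pos]

end BisectorFrame

/-- If the bisector of two circles with distinct centres is not empty, it crosses the line
through the centres. -/
theorem exists_bisectorFrame {a b x : Mink} {ρ τ : ℝ} (ha : a ∈ hypPlane) (hb : b ∈ hypPlane)
    (hab : a ≠ b) (hx : x ∈ hypPlane) (h : pow x a ρ = pow x b τ) :
    ∃ q u n γa γb, BisectorFrame a b ρ τ q u n γa γb := by
  rw [pow_eq hx ha, pow_eq hx hb, neg_inj] at h
  obtain ⟨v, d, hv, hd, rfl⟩ := exists_geo_eq ha hb hab
  obtain ⟨m, F⟩ := exists_frame ha hv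
  rw [lor_comm x (geo a v d), lor_geo_left, lor_comm a, lor_comm v] at h
  have hA := one_le_neg_lor hx ha
  have hVA : lor x v ^ 2 < lor x a ^ 2 := by
    have hself : lor x x = -1 := hx.1
    rw [F.expand x] at hself
    simp only [lor_add_left, lor_smul_left, lor_add_right, lor_smul_right, F.lor_q_q, F.lor_q_u,
      F.lor_q_n, F.lor_u_q, F.lor_u_u, F.lor_u_n, F.lor_n_q, F.lor_n_u, F.lor_n_n] at hself
    nlinarith [sq_nonneg (lor x m)]
  have habs : |lor x v| < -lor x a := abs_lt_of_sq_lt_sq (by linarith) (by linarith)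
  have hratio : lor x v / -lor x a ∈ Ioo (-1 : ℝ) 1 := by
    rw [abs_lt] at habs
    constructor
    · rw [lt_div_iff₀ (by linarith)]; linarith
    · rw [div_lt_iff₀ (by linarith)]; linarith
  set s := artanh (lor x v / -lor x a)
  have hs : sinh s * -lor x a = lor x v * cosh s := by
    have := tanh_artanh hratio
    rwa [tanh_eq_sinh_div_cosh, div_eq_div_iff (cosh_pos _).ne' (by linarith)] at this
  have hq := geo_mem ha hv s
  have hu := unitTangent_vel ha hv s
  obtain ⟨n, G⟩ := exists_frame hq hu
  refine ⟨geo a v s, vel a v s, n, s, d - s, hq, ?_, hu, G.normal, G.orth, ?_, ?_, by linarith⟩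
  · have hva : lor v a = 0 := F.lor_u_q
    rw [pow_eq hq ha, pow_eq hq hb, neg_inj, lor_geo_left, ha.1, hva, lor_comm _ (geo a v d),
      lor_geo_left, lor_comm a, lor_comm v, lor_geo_left, lor_geo_left, ha.1, hv.1, hv.2, hva]
    have hne : lor x a ≠ 0 := by linarith
    apply mul_left_cancel₀ hne
    linear_combination (-cosh s) * h + (cosh τ)⁻¹ * sinh d * hs
  · rw [geo_geo, add_neg_cancel, geo_zero]
  · rw [geo_geo, add_sub_cancel]

/-! ### Power cells and their areas -/

theorem isClosed_le_lor (a b : Mink) (α β : ℝ) :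
    IsClosed {x : Mink | α * lor x a ≤ β * lor x b} :=
  isClosed_le (continuous_const.mul (continuous_lor_right a))
    (continuous_const.mul (continuous_lor_right b))

section Cells

variable {N : ℕ} {Ω : Set Mink} {p : Fin N → Mink} {r : Fin N → ℝ}

/-- On `Ω` the power cells are cut out by linear inequalities. -/
theorem mem_cell_iff (hp : ∀ i, p i ∈ hypPlane) {x : Mink} (hx : x ∈ hypPlane) (i : Fin N) :
    x ∈ cell p r i ↔ ∀ k, (cosh (r k))⁻¹ * lor x (p k) ≤ (cosh (r i))⁻¹ * lor x (p i) := by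
  simp only [cell, mem_ofPred_eq, hx, true_and, pow_eq hx (hp _), neg_le_neg_iff]

theorem isClosed_cell_inter (hΩ : Ω ⊆ hypPlane) (hc : IsClosed Ω) (hp : ∀ i, p i ∈ hypPlane)
    (i : Fin N) : IsClosed (cell p r i ∩ Ω) := by
  have : cell p r i ∩ Ω = (⋂ k, {x : Mink | (cosh (r k))⁻¹ * lor x (p k) ≤
      (cosh (r i))⁻¹ * lor x (p i)}) ∩ Ω := by
    ext x
    simp only [mem_inter_iff, mem_iInter, mem_ofPred_eq, and_congr_left_iff]
    exact fun hx => mem_cell_iff hp (hΩ hx) i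
  rw [this]
  exact (isClosed_iInter fun k => isClosed_le_lor _ _ _ _).inter hc

theorem hypArea_lt_top {K : Set Mink} (hK : IsCompact K) : hypArea K < ⊤ := by
  have hq : (![0, 0, 1] : Mink) ∈ hypPlane := by constructor <;> simp [lor]
  have hu : UnitTangent (![0, 0, 1] : Mink) ![1, 0, 0] := by constructor <;> simp [lor]
  obtain ⟨n, F⟩ := exists_frame hq hu
  rw [F.hypArea_eq hK.isClosed.measurableSet]
  have hcont : Continuous fun z : ℝ × ℝ => cosh z.2 := by fun_prop
  exact (hcont.continuousOn.integrableOn_compact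
    (F.isCompact_preimage_fermi hK)).lintegral_lt_top

theorem hypArea_bisector {a b : Mink} {ρ τ : ℝ} (ha : a ∈ hypPlane) (hb : b ∈ hypPlane)
    (hab : a ≠ b) : hypArea {x | x ∈ hypPlane ∧ pow x a ρ = pow x b τ} = 0 := by
  rcases eq_empty_or_nonempty {x | x ∈ hypPlane ∧ pow x a ρ = pow x b τ} with h | ⟨x, hx, hxe⟩
  · rw [h, measure_empty]
  · obtain ⟨q, u, n, γa, γb, B⟩ := exists_bisectorFrame ha hb hab hx hxe
    refine measure_mono_null (fun y hy => ?_) B.frame.hypArea_line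
    exact ⟨hy.1, (B.pow_eq_iff hy.1).1 hy.2⟩

theorem pow_eq_of_mem_cells {x : Mink} {i j : Fin N} (hi : x ∈ cell p r i) (hj : x ∈ cell p r j) :
    pow x (p i) (r i) = pow x (p j) (r j) := le_antisymm (hi.2 j) (hj.2 i)

/-- The cells tile `Ω` up to null sets. -/
theorem sum_hypArea_cell [Nonempty (Fin N)] (hΩ : Ω ⊆ hypPlane) (hc : IsCompact Ω)
    (hp : ∀ i, p i ∈ hypPlane) (hinj : Function.Injective p) :
    ∑ i, (hypArea (cell p r i ∩ Ω)).toReal = (hypArea Ω).toReal := by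
  have hcover : Ω = ⋃ i, cell p r i ∩ Ω := by
    ext x
    simp only [mem_iUnion, mem_inter_iff, exists_and_right]
    refine ⟨fun hx => ⟨?_, hx⟩, fun hx => hx.2⟩
    obtain ⟨i, hi⟩ := Finite.exists_min fun i => pow x (p i) (r i)
    exact ⟨i, hΩ hx, hi⟩
  have hdisj : Pairwise (Function.onFun (AEDisjoint hypArea) fun i => cell p r i ∩ Ω) := by
    intro i j hij
    refine measure_mono_null ?_ (hypArea_bisector (ρ := r i) (τ := r j) (hp i) (hp j)
      (hinj.ne hij))
    exact fun x hx => ⟨hx.1.1.1, pow_eq_of_mem_cells hx.1.1 hx.2.1⟩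
  have hmeas : ∀ i, NullMeasurableSet (cell p r i ∩ Ω) hypArea := fun i =>
    (isClosed_cell_inter hΩ hc.isClosed hp i).measurableSet.nullMeasurableSet
  conv_rhs => rw [hcover]
  rw [measure_iUnion₀ hdisj hmeas, tsum_fintype, ENNReal.toReal_sum]
  exact fun i _ => ((measure_mono inter_subset_right).trans_lt (hypArea_lt_top hc)).ne

theorem cosh_radii {h : Fin N → ℝ} {k : Fin N} (hk : 0 ≤ h k) :
    cosh (radii h k) = exp (h k) := cosh_arcosh (one_le_exp hk)

/-- The part of `Ω` where the power to the `i`-th circle is at most that to any other circle but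
the `j`-th one, which is not compared. -/
def cellExcept (Ω : Set Mink) (p : Fin N → Mink) (r : Fin N → ℝ) (i j : Fin N) : Set Mink :=
  {x | x ∈ Ω ∧ ∀ k, k ≠ j → (cosh (r k))⁻¹ * lor x (p k) ≤ (cosh (r i))⁻¹ * lor x (p i)}

theorem isCompact_cellExcept (hc : IsCompact Ω) (i j : Fin N) :
    IsCompact (cellExcept Ω p r i j) := by
  have : cellExcept Ω p r i j = Ω ∩ ⋂ k, ⋂ (_ : k ≠ j), {x : Mink | (cosh (r k))⁻¹ * lor x (p k) ≤
      (cosh (r i))⁻¹ * lor x (p i)} := by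
    ext x; simp [cellExcept]
  rw [this]
  exact hc.inter_right
    (isClosed_iInter fun k => isClosed_iInter fun _ => isClosed_le_lor _ _ _ _)

/-- When only the `j`-th height moves, the `i`-th cell is cut out of a fixed set by a single
moving half-plane. -/
theorem cellArea_update (hΩ : Ω ⊆ hypPlane) (hp : ∀ i, p i ∈ hypPlane) {h : Fin N → ℝ}
    (hpos : ∀ i, 0 ≤ h i) (hr : ∀ i, cosh (r i) = exp (h i)) {i j : Fin N} (hij : i ≠ j) {t : ℝ}
    (ht : 0 ≤ t) :
    cellArea Ω p (Function.update h j t) i = (hypArea (cellExcept Ω p r i j ∩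
      {x | exp (-t) * lor x (p j) ≤ (cosh (r i))⁻¹ * lor x (p i)})).toReal := by
  have hu : ∀ k, cosh (radii (Function.update h j t) k) = exp (Function.update h j t k) := by
    intro k
    refine cosh_radii ?_
    rcases eq_or_ne k j with rfl | hk
    · simpa using ht
    · simpa [hk] using hpos k
  rw [cellArea]
  congr 2
  ext x
  simp only [mem_inter_iff, cellExcept, mem_ofPred_eq]
  constructor
  · rintro ⟨hx, hxΩ⟩
    rw [mem_cell_iff hp (hΩ hxΩ)] at hx
    simp only [hu] at hx
    refine ⟨⟨hxΩ, fun k hk => ?_⟩, ?_⟩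
    · simpa [hk, hij, hr] using hx k
    · simpa [hij, hr, exp_neg] using hx j
  · rintro ⟨⟨hxΩ, hx⟩, hxj⟩
    refine ⟨?_, hxΩ⟩
    rw [mem_cell_iff hp (hΩ hxΩ)]
    intro k
    simp only [hu]
    rcases eq_or_ne k j with rfl | hk
    · simpa [hij, hr, exp_neg] using hxj
    · simpa [hk, hij, hr] using hx k hk

theorem mem_edge_iff (hΩ : Ω ⊆ hypPlane) (hp : ∀ i, p i ∈ hypPlane) {i j : Fin N} {x : Mink} :
    x ∈ edge Ω p r i j ↔ x ∈ cellExcept Ω p r i j ∧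
      (cosh (r j))⁻¹ * lor x (p j) = (cosh (r i))⁻¹ * lor x (p i) := by
  simp only [edge, mem_inter_iff, cellExcept, mem_ofPred_eq]
  constructor
  · rintro ⟨⟨hi, hj⟩, hxΩ⟩
    rw [mem_cell_iff hp (hΩ hxΩ)] at hi hj
    exact ⟨⟨hxΩ, fun k _ => hi k⟩, le_antisymm (hi j) (hj i)⟩
  · rintro ⟨⟨hxΩ, hx⟩, hxj⟩
    have hi : ∀ k, (cosh (r k))⁻¹ * lor x (p k) ≤ (cosh (r i))⁻¹ * lor x (p i) := by
      intro k
      rcases eq_or_ne k j with rfl | hk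
      · exact hxj.le
      · exact hx k hk
    rw [mem_cell_iff hp (hΩ hxΩ), mem_cell_iff hp (hΩ hxΩ)]
    exact ⟨⟨hi, fun k => hxj ▸ hi k⟩, hxΩ⟩

/-- Cells without a common point in `Ω` do not feel each other's heights. -/
theorem hasDerivAt_cellArea_of_edge_eq_empty (hΩ : Ω ⊆ hypPlane) (hc : IsCompact Ω)
    (hp : ∀ i, p i ∈ hypPlane) {h : Fin N → ℝ}
    (hpos : ∀ i, 0 < h i) (hr : ∀ i, cosh (r i) = exp (h i)) {i j : Fin N} (hij : i ≠ j)
    (hE : edge Ω p r i j = ∅) :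
    HasDerivAt (fun t => cellArea Ω p (Function.update h j t) i) 0 (h j) := by
  have hcont : Continuous fun z : ℝ × Mink =>
      exp (-z.1) * lor z.2 (p j) - (cosh (r i))⁻¹ * lor z.2 (p i) := by
    unfold lor; fun_prop
  have hev : ∀ᶠ t in 𝓝 (h j), ∀ x ∈ cellExcept Ω p r i j,
      (exp (-t) * lor x (p j) ≤ (cosh (r i))⁻¹ * lor x (p i) ↔
        exp (-h j) * lor x (p j) ≤ (cosh (r i))⁻¹ * lor x (p i)) := by
    refine (isCompact_cellExcept hc i j).eventually_forall_of_forall_eventually fun x hx => ?_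
    have hne : exp (-h j) * lor x (p j) - (cosh (r i))⁻¹ * lor x (p i) ≠ 0 := by
      intro h0
      have : x ∈ edge Ω p r i j :=
        (mem_edge_iff hΩ hp).2 ⟨hx, by rw [hr j, ← exp_neg]; linarith⟩
      rw [hE] at this
      exact this
    have hc2 : Continuous fun z : ℝ × Mink =>
      exp (-h j) * lor z.2 (p j) - (cosh (r i))⁻¹ * lor z.2 (p i) := by
      unfold lor; fun_prop
    rcases lt_or_gt_of_ne hne with hneg | hpos'
    · filter_upwards [(hcont.tendsto (h j, x)).eventually_lt_const hneg,
        (hc2.tendsto (h j, x)).eventually_lt_const hneg] with z h1 h2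
      exact iff_of_true (by linarith) (by linarith)
    · filter_upwards [(hcont.tendsto (h j, x)).eventually_const_lt hpos',
        (hc2.tendsto (h j, x)).eventually_const_lt hpos'] with z h1 h2
      exact iff_of_false (by linarith) (by linarith)
  refine (hasDerivAt_const (h j) (cellArea Ω p (Function.update h j (h j)) i)).congr_of_eventuallyEq
    ?_
  filter_upwards [hev, lt_mem_nhds (hpos j)] with t ht ht0
  rw [cellArea_update hΩ hp (fun k => (hpos k).le) hr hij ht0.le,
    cellArea_update hΩ hp (fun k => (hpos k).le) hr hij (hpos j).le]
  congr 2
  ext x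
  simp only [mem_inter_iff, mem_ofPred_eq]
  exact and_congr_right fun hx => ht x hx

end Cells

/-! ### Edges and the derivative of a cell area -/

section Cells

variable {N : ℕ} {Ω : Set Mink} {p : Fin N → Mink} {r : Fin N → ℝ}

theorem edge_comm (i j : Fin N) : edge Ω p r i j = edge Ω p r j i := by
  rw [edge, edge, inter_comm (cell p r i)]

/-- Distinct centres stay distinct after weighting: `lor x x = -1` recovers the weights. -/
theorem eq_of_weighted_eq {a b : Mink} {ρ τ : ℝ} (ha : a ∈ hypPlane) (hb : b ∈ hypPlane)
    (h : (cosh ρ)⁻¹ • a = (cosh τ)⁻¹ • b) : a = b := by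
  have h1 : lor ((cosh ρ)⁻¹ • a) ((cosh ρ)⁻¹ • a) = lor ((cosh τ)⁻¹ • b) ((cosh τ)⁻¹ • b) := by
    rw [h]
  simp only [lor_smul_left, lor_smul_right, ha.1, hb.1] at h1
  have h2 : (cosh ρ)⁻¹ = (cosh τ)⁻¹ := by
    refine (pow_left_inj₀ (by positivity) (by positivity) two_ne_zero).1 ?_
    linear_combination -h1
  rw [h2] at h
  exact smul_right_injective Mink (inv_ne_zero (cosh_pos τ).ne') h

/-- A cell squeezed between two others that share its bisector line has area zero. -/
theorem hypArea_cell_eq_zero {q u n : Mink} (F : Frame q u n) (hΩ : Ω ⊆ hypPlane)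
    (hp : ∀ i, p i ∈ hypPlane) {m a b : Fin N} {α β : ℝ}
    (ha : (cosh (r a))⁻¹ • p a = (cosh (r m))⁻¹ • p m + α • u)
    (hb : (cosh (r b))⁻¹ • p b = (cosh (r m))⁻¹ • p m + β • u) (hαβ : α * β < 0) :
    hypArea (cell p r m ∩ Ω) = 0 := by
  refine measure_mono_null ?_ F.hypArea_line
  rintro x ⟨hx, hxΩ⟩
  have hx2 := (mem_cell_iff hp (hΩ hxΩ) m).1 hx
  have h1 := hx2 a
  have h2 := hx2 b
  rw [← lor_smul_right, ha, lor_add_right, lor_smul_right, lor_smul_right] at h1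
  rw [← lor_smul_right, hb, lor_add_right, lor_smul_right, lor_smul_right] at h2
  refine ⟨hΩ hxΩ, ?_⟩
  have h3 : α * lor x u ≤ 0 := by linarith
  have h4 : β * lor x u ≤ 0 := by linarith
  have h5 : 0 ≤ α * β * lor x u ^ 2 := by nlinarith [mul_nonneg_of_nonpos_of_nonpos h3 h4]
  by_contra hne
  have : 0 < lor x u ^ 2 := by positivity
  nlinarith

/-- Three cells of positive area cannot share a bisector line. -/
theorem weighted_not_collinear {q u n : Mink} (F : Frame q u n) (hΩ : Ω ⊆ hypPlane)
    (hp : ∀ i, p i ∈ hypPlane) (hinj : Function.Injective p) {i j k : Fin N} (hij : i ≠ j)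
    (hik : i ≠ k) (hjk : j ≠ k) (hi : 0 < hypArea (cell p r i ∩ Ω))
    (hj : 0 < hypArea (cell p r j ∩ Ω)) (hk : 0 < hypArea (cell p r k ∩ Ω)) {β κ : ℝ}
    (hβ : (cosh (r j))⁻¹ • p j = (cosh (r i))⁻¹ • p i + β • u)
    (hκ : (cosh (r k))⁻¹ • p k = (cosh (r i))⁻¹ • p i + κ • u) : False := by
  have hβ0 : β ≠ 0 := by
    rintro rfl
    rw [zero_smul, add_zero] at hβ
    exact hij (hinj (eq_of_weighted_eq (hp j) (hp i) hβ)).symm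
  have hκ0 : κ ≠ 0 := by
    rintro rfl
    rw [zero_smul, add_zero] at hκ
    exact hik (hinj (eq_of_weighted_eq (hp k) (hp i) hκ)).symm
  have hβκ : β ≠ κ := by
    rintro rfl
    exact hjk (hinj (eq_of_weighted_eq (hp j) (hp k) (hβ.trans hκ.symm)))
  have hj1 : (cosh (r i))⁻¹ • p i = (cosh (r j))⁻¹ • p j + (-β) • u := by rw [hβ]; module
  have hj2 : (cosh (r k))⁻¹ • p k = (cosh (r j))⁻¹ • p j + (κ - β) • u := by rw [hβ, hκ]; module
  have hk1 : (cosh (r i))⁻¹ • p i = (cosh (r k))⁻¹ • p k + (-κ) • u := by rw [hκ]; module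
  have hk2 : (cosh (r j))⁻¹ • p j = (cosh (r k))⁻¹ • p k + (β - κ) • u := by rw [hβ, hκ]; module
  -- one of the three parameters `0`, `β`, `κ` lies strictly between the other two
  rcases lt_or_gt_of_ne (mul_ne_zero hβ0 hκ0) with h | h
  · exact hi.ne' (hypArea_cell_eq_zero F hΩ hp hβ hκ h)
  · have hsq : 0 < (β - κ) ^ 2 := by
      have := sub_ne_zero.2 hβκ
      positivity
    rcases lt_or_ge (-β * (κ - β)) 0 with h' | h'
    · exact hj.ne' (hypArea_cell_eq_zero F hΩ hp hj1 hj2 h')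
    · refine hk.ne' (hypArea_cell_eq_zero F hΩ hp hk1 hk2 ?_)
      by_contra h''
      have h3 := mul_nonneg h' (not_lt.1 h'')
      nlinarith [mul_pos h hsq]

/-- A function `A cosh s + B sinh s` that is nonnegative around a zero vanishes identically. -/
theorem coeff_eq_zero_of_nonneg {A B s₁ s₂ s : ℝ} (hs : s ∈ Ioo s₁ s₂)
    (h : ∀ t ∈ Icc s₁ s₂, 0 ≤ cosh t * A + sinh t * B) (h0 : cosh s * A + sinh s * B = 0) :
    A = 0 ∧ B = 0 := by
  have key : ∀ t, cosh s * (cosh t * A + sinh t * B) = sinh (t - s) * B := by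
    intro t
    rw [sinh_sub]; linear_combination cosh t * h0
  have h1 : 0 ≤ sinh (s₁ - s) * B := by
    rw [← key]
    exact mul_nonneg (cosh_pos s).le (h _ ⟨le_rfl, (hs.1.trans hs.2).le⟩)
  have h2 : 0 ≤ sinh (s₂ - s) * B := by
    rw [← key]
    exact mul_nonneg (cosh_pos s).le (h _ ⟨(hs.1.trans hs.2).le, le_rfl⟩)
  have k1 : sinh (s₁ - s) < 0 := sinh_neg_iff.2 (sub_neg.2 hs.1)
  have k2 : 0 < sinh (s₂ - s) := sinh_pos_iff.2 (sub_pos.2 hs.2)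
  have hB : B = 0 := by
    apply le_antisymm
    · by_contra hlt
      nlinarith [mul_neg_of_neg_of_pos k1 (not_le.1 hlt)]
    · exact nonneg_of_mul_nonneg_right h2 k2
  refine ⟨?_, hB⟩
  rw [hB, mul_zero, add_zero] at h0
  exact (mul_eq_zero.1 h0).resolve_left (cosh_pos s).ne'

/-- A cell of positive area has points off any given geodesic. -/
theorem exists_mem_cell_lor_ne_zero {q u n : Mink} (F : Frame q u n) (hΩ : Ω ⊆ hypPlane)
    {i : Fin N} (hi : 0 < hypArea (cell p r i ∩ Ω)) :
    ∃ x ∈ cell p r i ∩ Ω, lor x u ≠ 0 := by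
  by_contra! h
  refine hi.ne' (measure_mono_null (fun x hx => ?_) F.hypArea_line)
  exact ⟨hΩ hx.2, h x hx⟩

theorem geo_injective {q n : Mink} (hn : UnitTangent q n) : Function.Injective (geo q n) := by
  intro s t h
  have h1 : lor (geo q n s) n = lor (geo q n t) n := by rw [h]
  rw [lor_geo_left, lor_geo_left, hn.1, hn.2] at h1
  exact sinh_injective (by linarith)

theorem fermi_zero (q u n : Mink) (s : ℝ) : fermi q u n (0, s) = geo q n s := by
  rw [fermi, geo_zero]

/-- A point in the relative interior of an edge stays in `cellExcept` when it is moved slightly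
across the bisector. This is where non-degeneracy and the convexity of `Ω` enter. -/
theorem eventually_fermi_mem_cellExcept (hΩ : Ω ⊆ hypPlane) (hconvex : GeodesicallyConvex Ω)
    (hp : ∀ i, p i ∈ hypPlane) (hinj : Function.Injective p)
    (hnondeg : ∀ i, (cell p r i ∩ Ω).Nonempty → 0 < hypArea (cell p r i ∩ Ω))
    {i j : Fin N} (hij : i ≠ j) {q u n : Mink} {γi γj dk dl : ℝ}
    (B : BisectorFrame (p i) (p j) (r i) (r j) q u n γi γj)
    (hE : edge Ω p r i j = geo q n '' Icc (-dl) dk) {s : ℝ} (hs : s ∈ Ioo (-dl) dk) :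
    ∀ᶠ y in 𝓝 (0 : ℝ), fermi q u n (y, s) ∈ cellExcept Ω p r i j := by
  have F := B.frame
  have hmem : ∀ t ∈ Icc (-dl) dk, geo q n t ∈ edge Ω p r i j := fun t ht =>
    hE ▸ mem_image_of_mem _ ht
  have hsE := hmem s (Ioo_subset_Icc_self hs)
  have hi := hnondeg i ⟨_, hsE.1.1, hsE.2⟩
  have hj := hnondeg j ⟨_, hsE.1.2, hsE.2⟩
  obtain ⟨x, ⟨hxi, hxΩ⟩, hxu⟩ := exists_mem_cell_lor_ne_zero F hΩ hi
  obtain ⟨z, ⟨hzj, hzΩ⟩, hzu⟩ := exists_mem_cell_lor_ne_zero F hΩ hj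
  have hxneg : lor x u < 0 := by
    refine lt_of_le_of_ne ?_ hxu
    have h1 := (mem_cell_iff hp (hΩ hxΩ) i).1 hxi j
    have h2 := B.weighted_sub x
    by_contra hlt
    have := mul_pos B.sinh_pos (not_le.1 hlt)
    linarith
  have hzpos : 0 < lor z u := by
    refine lt_of_le_of_ne ?_ hzu.symm
    have h1 := (mem_cell_iff hp (hΩ hzΩ) j).1 hzj i
    have h2 := B.weighted_sub z
    by_contra hlt
    have := mul_neg_of_pos_of_neg B.sinh_pos (not_le.1 hlt)
    linarith
  have hΩev := F.eventually_fermi_mem hΩ hconvex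
    (fun t ht => (hmem t (Ioo_subset_Icc_self ht)).2) hs hzΩ hzpos hxΩ hxneg
  have hstrict : ∀ k, ∀ᶠ y in 𝓝 (0 : ℝ), k ≠ j → (cosh (r k))⁻¹ * lor (fermi q u n (y, s)) (p k) ≤
      (cosh (r i))⁻¹ * lor (fermi q u n (y, s)) (p i) := by
    intro k
    by_cases hkj : k = j
    · exact Eventually.of_forall fun y h => absurd hkj h
    by_cases hki : k = i
    · subst hki
      exact Eventually.of_forall fun y _ => le_rfl
    have hle : ∀ t ∈ Icc (-dl) dk, (cosh (r k))⁻¹ * lor (geo q n t) (p k) ≤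
        (cosh (r i))⁻¹ * lor (geo q n t) (p i) := fun t ht =>
      ((mem_edge_iff hΩ hp).1 (hmem t ht)).1.2 k hkj
    have hlt : (cosh (r k))⁻¹ * lor (geo q n s) (p k) < (cosh (r i))⁻¹ * lor (geo q n s) (p i) := by
      refine lt_of_le_of_ne (hle s (Ioo_subset_Icc_self hs)) fun heq => ?_
      -- equality would make the `k`-th circle coaxal with the `i`-th and `j`-th ones
      have hskell : geo q n s ∈ cell p r k := by
        rw [mem_cell_iff hp (hΩ hsE.2), heq]
        exact (mem_cell_iff hp (hΩ hsE.2) i).1 hsE.1.1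
      have hk := hnondeg k ⟨_, hskell, hsE.2⟩
      set W := (cosh (r k))⁻¹ • p k - (cosh (r i))⁻¹ • p i with hW
      have hWlor : ∀ x, lor x W = (cosh (r k))⁻¹ * lor x (p k) - (cosh (r i))⁻¹ * lor x (p i) := by
        intro x
        rw [hW, lor_sub_right, lor_smul_right, lor_smul_right]
      have hzero := coeff_eq_zero_of_nonneg (A := -lor q W) (B := -lor n W) hs
        (fun t ht => by
          have h1 := hle t ht
          have h2 := hWlor (geo q n t)
          rw [lor_geo_left] at h2
          linarith)
        (by
          have h2 := hWlor (geo q n s)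
          rw [lor_geo_left] at h2
          linarith)
      have hWu : W = lor W u • u := by
        have := F.expand W
        rw [lor_comm W q, lor_comm W n, hzero.1, neg_eq_zero.1 hzero.2] at this
        simpa using this
      set V := (cosh (r j))⁻¹ • p j - (cosh (r i))⁻¹ • p i with hV
      have hVlor : ∀ x, lor x V =
          ((cosh (r i))⁻¹ * sinh γi + (cosh (r j))⁻¹ * sinh γj) * lor x u := by
        intro x
        rw [hV, lor_sub_right, lor_smul_right, lor_smul_right, B.weighted_sub]
      have hVu : V = lor V u • u := by
        have := F.expand V
        rw [lor_comm V q, lor_comm V n, hVlor q, hVlor n, F.lor_q_u, F.lor_n_u] at this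
        simpa using this
      refine weighted_not_collinear F hΩ hp hinj hij (Ne.symm hki) (Ne.symm hkj) hi hj hk
        (β := lor V u) (κ := lor W u) ?_ ?_
      · rw [← hVu, hV]; abel
      · rw [← hWu, hW]; abel
    have hcont : ∀ a : Mink, Continuous fun y : ℝ => lor (fermi q u n (y, s)) a := fun a =>
      (continuous_lor_right a).comp ((continuous_fermi q u n).comp (by fun_prop))
    have hlt0 : (cosh (r k))⁻¹ * lor (fermi q u n (0, s)) (p k) <
        (cosh (r i))⁻¹ * lor (fermi q u n (0, s)) (p i) := by
      rw [fermi_zero]; exact hlt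
    have := (continuous_const.mul (hcont (p k))).continuousAt.eventually_lt
      (continuous_const.mul (hcont (p i))).continuousAt hlt0
    filter_upwards [this] with y hy _ using hy.le
  filter_upwards [hΩev, eventually_all.2 hstrict] with y h1 h2
  exact ⟨h1, h2⟩

/-- The derivative of a cell area in a neighbouring height. -/
theorem hasDerivAt_cellArea_of_edge_eq (hΩ : Ω ⊆ hypPlane) (hc : IsCompact Ω)
    (hconvex : GeodesicallyConvex Ω)
    (hp : ∀ i, p i ∈ hypPlane) (hinj : Function.Injective p)
    (hnondeg : ∀ i, (cell p r i ∩ Ω).Nonempty → 0 < hypArea (cell p r i ∩ Ω))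
    {h : Fin N → ℝ} (hpos : ∀ i, 0 < h i) (hr : ∀ i, cosh (r i) = exp (h i))
    {i j : Fin N} (hij : i ≠ j) {q u n : Mink} {γi γj dk dl : ℝ}
    (B : BisectorFrame (p i) (p j) (r i) (r j) q u n γi γj) (hd : -dl ≤ dk)
    (hE : edge Ω p r i j = geo q n '' Icc (-dl) dk) :
    HasDerivAt (fun t => cellArea Ω p (Function.update h j t) i)
      (-(sinh dk + sinh dl) / (tanh γi + tanh γj)) (h j) := by
  have F := B.frame
  set ci := (cosh (r i))⁻¹ with hci
  set cj := (cosh (r j))⁻¹ with hcj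
  have hcj' : cj = exp (-h j) := by rw [hcj, hr j, exp_neg]
  have hcj0 : 0 < cj := by rw [hcj']; exact exp_pos _
  have hseg : ∀ s, fermi q u n (0, s) ∈ cellExcept Ω p r i j → s ∈ Icc (-dl) dk := by
    intro s hs
    rw [fermi_zero] at hs
    have hmem : geo q n s ∈ edge Ω p r i j := by
      refine (mem_edge_iff hΩ hp).2 ⟨hs, ?_⟩
      have := B.weighted_sub (geo q n s)
      rw [lor_geo_left _ _ u, F.lor_q_u, F.lor_n_u] at this
      linarith
    rw [hE] at hmem
    obtain ⟨t, ht, hts⟩ := hmem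
    exact geo_injective B.normal hts ▸ ht
  have hV := F.hasDerivAt_hypArea (isCompact_cellExcept hc i j) hd hseg fun s hs =>
    eventually_fermi_mem_cellExcept hΩ hconvex hp hinj hnondeg hij B hE hs
  -- the bisector at height `t` is `lor x u + T t * lor x q = 0` with `T = num / den`
  let num : ℝ → ℝ := fun t => exp (-t) * cosh γj - ci * cosh γi
  let den : ℝ → ℝ := fun t => ci * sinh γi + exp (-t) * sinh γj
  have hexp : HasDerivAt (fun t : ℝ => exp (-t)) (-cj) (h j) := by
    have := (hasDerivAt_neg (h j)).exp
    rwa [← hcj', mul_neg_one] at this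
  have hnum : HasDerivAt num (-cj * cosh γj) (h j) := (hexp.mul_const _).sub_const _
  have hden : HasDerivAt den (-cj * sinh γj) (h j) := (hexp.mul_const _).const_add _
  have hnum0 : num (h j) = 0 := by
    have := B.cosh_eq
    simp only [num, ← hcj']; linarith
  have hdeneq : den (h j) = cj * cosh γj * (tanh γi + tanh γj) := by
    simp only [den, ← hcj']; exact B.sinh_eq
  have htanh := B.tanh_add_pos
  have hcγ := cosh_pos γj
  have hden0 : 0 < den (h j) := by rw [hdeneq]; positivity
  have hT : HasDerivAt (fun t => num t / den t) (-1 / (tanh γi + tanh γj)) (h j) := by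
    refine (hnum.fun_div hden hden0.ne').congr_deriv ?_
    rw [hnum0, hdeneq]; field_simp; ring
  have hT0 : num (h j) / den (h j) = 0 := by rw [hnum0, zero_div]
  have hcomp := HasDerivAt.comp (h j) (h := fun t => num t / den t) (by rw [hT0]; exact hV) hT
  refine (hcomp.congr_deriv ?_).congr_of_eventuallyEq ?_
  · rw [sinh_neg]; field_simp; ring
  filter_upwards [hden.continuousAt.eventually (lt_mem_nhds hden0), lt_mem_nhds (hpos j)]
    with t ht ht0
  rw [cellArea_update hΩ hp (fun k => (hpos k).le) hr hij ht0.le]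
  simp only [Function.comp_apply]
  congr 3
  ext x
  simp only [mem_ofPred_eq]
  have hx : exp (-t) * lor x (p j) - ci * lor x (p i)
      = den t • (lor x u + num t / den t * lor x q) := by
    rw [B.lor_left, B.lor_right, smul_eq_mul]
    field_simp
    simp only [num, den]; ring
  rw [← sub_nonpos, hx, smul_nonpos_iff_nonpos_of_pos_left ht]

/-- A nonempty edge is a geodesic segment on the bisector. -/
theorem exists_edge_eq (hΩ : Ω ⊆ hypPlane) (hc : IsCompact Ω) (hconvex : GeodesicallyConvex Ω)
    (hp : ∀ i, p i ∈ hypPlane) {i j : Fin N} {q u n : Mink} {γi γj : ℝ}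
    (B : BisectorFrame (p i) (p j) (r i) (r j) q u n γi γj) (hE : (edge Ω p r i j).Nonempty) :
    ∃ dk dl, -dl ≤ dk ∧ edge Ω p r i j = geo q n '' Icc (-dl) dk := by
  have F := B.frame
  have hcompact : IsCompact (edge Ω p r i j) := by
    have : edge Ω p r i j = (cell p r i ∩ Ω) ∩ (cell p r j ∩ Ω) := by
      rw [edge, inter_inter_distrib_right]
    rw [this]
    exact hc.of_isClosed_subset ((isClosed_cell_inter hΩ hc.isClosed hp i).inter
      (isClosed_cell_inter hΩ hc.isClosed hp j)) fun x hx => hx.1.2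
  set T : Set ℝ := {s | geo q n s ∈ edge Ω p r i j} with hT
  have himage : edge Ω p r i j = geo q n '' T := by
    ext x
    constructor
    · intro hx
      obtain ⟨⟨y, s⟩, rfl⟩ := F.exists_fermi_eq (hΩ hx.2)
      have h1 := (B.pow_eq_iff (hΩ hx.2)).1 (pow_eq_of_mem_cells hx.1.1 hx.1.2)
      rw [F.lor_fermi_u] at h1
      have h2 : y = 0 := sinh_eq_zero.1 ((mul_eq_zero.1 h1).resolve_left (cosh_pos _).ne')
      subst h2
      rw [fermi_zero] at hx ⊢
      exact mem_image_of_mem _ hx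
    · rintro ⟨s, hs, rfl⟩
      exact hs
  have hTcompact : IsCompact T := by
    have hclosed : IsClosed T := hcompact.isClosed.preimage (by unfold geo; fun_prop)
    refine ((F.isCompact_preimage_fermi hcompact).image continuous_snd).of_isClosed_subset hclosed
      fun s hs => ⟨(0, s), ?_, rfl⟩
    rw [mem_preimage, fermi_zero]
    exact hs
  have hTnonempty : T.Nonempty := by
    rw [himage] at hE
    exact hE.of_image
  have hTconn : IsConnected T := by
    refine ⟨hTnonempty, (ordConnected_def.2 ?_ : T.OrdConnected).isPreconnected⟩
    intro s hs t ht m hm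
    have hgeo : ∀ τ, geo q n τ = geo (geo q n s) (vel q n s) (τ - s) := by
      intro τ
      rw [geo_geo, add_sub_cancel]
    have hmΩ : geo q n m ∈ Ω := by
      rw [hgeo]
      refine hconvex _ hs.2 _ (unitTangent_vel B.mem B.normal s) (t - s)
        (by linarith [hm.1, hm.2]) (by rw [← hgeo]; exact ht.2) _ ⟨?_, ?_⟩ <;>
        linarith [hm.1, hm.2]
    -- on the bisector a half-plane is an inequality for a combination of `cosh` and `sinh`
    rw [hT, mem_ofPred_eq, mem_edge_iff hΩ hp] at hs ht ⊢
    refine ⟨⟨hmΩ, fun k hk => ?_⟩, ?_⟩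
    · have h1 := hs.1.2 k hk
      have h2 := ht.1.2 k hk
      simp only [lor_geo_left] at h1 h2 ⊢
      rcases hm.1.eq_or_lt with rfl | hsm
      · exact h1
      have k1 : 0 ≤ sinh (t - m) := sinh_nonneg_iff.2 (by linarith [hm.2])
      have k2 : 0 < sinh (m - s) := sinh_pos_iff.2 (by linarith)
      have k3 : 0 < sinh (t - s) := sinh_pos_iff.2 (by linarith [hm.2])
      set X := (cosh (r i))⁻¹ * lor q (p i) - (cosh (r k))⁻¹ * lor q (p k) with hX
      set Y := (cosh (r i))⁻¹ * lor n (p i) - (cosh (r k))⁻¹ * lor n (p k) with hY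
      have h3 : 0 ≤ cosh s * X + sinh s * Y := by rw [hX, hY]; linarith
      have h4 : 0 ≤ cosh t * X + sinh t * Y := by rw [hX, hY]; linarith
      have hid : sinh (t - s) * (cosh m * X + sinh m * Y) =
          sinh (t - m) * (cosh s * X + sinh s * Y) + sinh (m - s) * (cosh t * X + sinh t * Y) := by
        simp only [sinh_sub]; ring
      have h5 : 0 ≤ cosh m * X + sinh m * Y := by
        refine nonneg_of_mul_nonneg_right (?_ : 0 ≤ sinh (t - s) * _) k3
        rw [hid]; positivity
      rw [hX, hY] at h5
      linarith
    · have := B.weighted_sub (geo q n m)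
      rw [lor_geo_left _ _ u, F.lor_q_u, F.lor_n_u] at this
      linarith
  refine ⟨sSup T, -sInf T, ?_, ?_⟩
  · rw [neg_neg]
    exact csInf_le_csSup hTnonempty hTcompact.bddBelow hTcompact.bddAbove
  · rw [neg_neg, ← eq_Icc_of_connected_compact hTconn hTcompact, ← himage]

/-- The power centres on both sides of the line of centres are the end points of the edge. -/
theorem edge_eq_of_power_centres (hΩ : Ω ⊆ hypPlane) (hc : IsCompact Ω)
    (hconvex : GeodesicallyConvex Ω) (hp : ∀ i, p i ∈ hypPlane) {i j k l : Fin N} {q u n : Mink}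
    {γi γj dk dl : ℝ} (B : BisectorFrame (p i) (p j) (r i) (r j) q u n γi γj)
    (hk : 0 < lor (p k) n) (hl : lor (p l) n < 0)
    (hdk : geo q n dk ∈ edge Ω p r i j ∩ cell p r k)
    (hdl : geo q n (-dl) ∈ edge Ω p r i j ∩ cell p r l) :
    -dl ≤ dk ∧ edge Ω p r i j = geo q n '' Icc (-dl) dk := by
  have F := B.frame
  obtain ⟨e, f, -, hE⟩ := exists_edge_eq hΩ hc hconvex hp B ⟨_, hdk.1⟩
  have hpin : lor n (p i) = 0 := by rw [B.lor_left, F.lor_n_q, F.lor_n_u]; ring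
  -- along the bisector, the `i`-th and `m`-th powers are equal at one parameter `d` only
  have key : ∀ (m : Fin N) (s d : ℝ), geo q n s ∈ edge Ω p r i j →
      geo q n d ∈ edge Ω p r i j ∩ cell p r m → sinh (s - d) * lor (p m) n ≤ 0 := by
    intro m s d hs hd
    have h1 := (mem_cell_iff hp (hΩ hs.2) i).1 hs.1.1 m
    have h2 := (mem_cell_iff hp (hΩ hd.1.2) i).1 hd.1.1.1 m
    have h3 := (mem_cell_iff hp (hΩ hd.1.2) m).1 hd.2 i
    have h4 := le_antisymm h2 h3
    simp only [lor_geo_left, hpin] at h1 h4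
    have hcd := cosh_pos d
    have hcm : 0 < (cosh (r m))⁻¹ := by positivity
    rw [lor_comm (p m), sinh_sub]
    have h5 : (cosh (r m))⁻¹ * ((sinh s * cosh d - cosh s * sinh d) * lor n (p m))
        = cosh d * ((cosh (r m))⁻¹ * (cosh s * lor q (p m) + sinh s * lor n (p m))
          - (cosh (r i))⁻¹ * (cosh s * lor q (p i) + sinh s * 0)) := by
      linear_combination -cosh s * h4
    by_contra hlt
    have h6 := mul_pos hcm (not_le.1 hlt)
    rw [h5] at h6
    have h7 := pos_of_mul_pos_right h6 hcd.le
    linarith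
  have hupper : ∀ s, geo q n s ∈ edge Ω p r i j → s ≤ dk := by
    intro s hs
    have := key k s dk hs hdk
    rw [← sub_nonpos, ← sinh_nonpos_iff]
    by_contra hlt
    linarith [mul_pos (not_le.1 hlt) hk]
  have hlower : ∀ s, geo q n s ∈ edge Ω p r i j → -dl ≤ s := by
    intro s hs
    have := key l s (-dl) hs hdl
    rw [← sub_nonneg, ← sinh_nonneg_iff]
    by_contra hlt
    linarith [mul_pos_of_neg_of_neg (not_le.1 hlt) hl]
  have hT : ∀ s, geo q n s ∈ edge Ω p r i j ↔ s ∈ Icc (-f) e := by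
    intro s
    rw [hE]
    exact (geo_injective B.normal).mem_set_image
  refine ⟨hlower dk hdk.1, ?_⟩
  rw [hE]
  congr 1
  refine Subset.antisymm (fun s hs => ?_) (Icc_subset_Icc ?_ ?_)
  · exact ⟨hlower s ((hT s).2 hs), hupper s ((hT s).2 hs)⟩
  · exact ((hT _).1 hdl.1).1
  · exact ((hT _).1 hdk.1).2

end Cells

/-! ### The diagonal derivatives and the conclusion -/

/-- The areas of the cells sum up to the area of `Ω`, so the derivative of one area in its own
height is determined by those of the others. -/
theorem hasDerivAt_cellArea_self {N : ℕ} {Ω : Set Mink} {p : Fin N → Mink} (hΩ : Ω ⊆ hypPlane)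
    (hc : IsCompact Ω) (hp : ∀ i, p i ∈ hypPlane) (hinj : Function.Injective p) {h : Fin N → ℝ}
    {i : Fin N} {D : Fin N → ℝ}
    (hD : ∀ j, j ≠ i → HasDerivAt (fun t => cellArea Ω p (Function.update h i t) j) (D j) (h i)) :
    HasDerivAt (fun t => cellArea Ω p (Function.update h i t) i)
      (-∑ j ∈ Finset.univ.erase i, D j) (h i) := by
  have : Nonempty (Fin N) := ⟨i⟩
  have hsum : HasDerivAt
      (fun t => ∑ j ∈ Finset.univ.erase i, cellArea Ω p (Function.update h i t) j)
      (∑ j ∈ Finset.univ.erase i, D j) (h i) :=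
    HasDerivAt.fun_sum fun j hj => hD j (Finset.ne_of_mem_erase hj)
  have hfun : (fun t => cellArea Ω p (Function.update h i t) i) = fun t =>
      (hypArea Ω).toReal - ∑ j ∈ Finset.univ.erase i, cellArea Ω p (Function.update h i t) j := by
    funext t
    have htotal : ∑ j, cellArea Ω p (Function.update h i t) j = (hypArea Ω).toReal :=
      sum_hypArea_cell hΩ hc hp hinj
    rw [← htotal, ← Finset.add_sum_erase _ _ (Finset.mem_univ i), add_sub_cancel_right]
  rw [hfun]
  exact hsum.const_sub _

end HypPower

open HypPower in
theorem theorem5 {N : ℕ} (Ω : Set Mink) (hΩ : Ω ⊆ hypPlane) (hcompact : IsCompact Ω)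
    (hconvex : GeodesicallyConvex Ω)
    (p : Fin N → Mink) (hp : ∀ i, p i ∈ Ω) (hinj : Function.Injective p)
    (r : Fin N → ℝ) (hr : ∀ i, 0 < r i)
    (hnondeg : ∀ i, (cell p r i ∩ Ω).Nonempty → 0 < hypArea (cell p r i ∩ Ω))
    (h : Fin N → ℝ) (hh : ∀ i, h i = Real.log (Real.cosh (r i))) :
    ∃ D : Fin N → Fin N → ℝ,
      -- `D i j` is the partial derivative of `w i` with respect to `h j`
      (∀ i j, HasDerivAt (fun t => cellArea Ω p (Function.update h j t) i) (D i j) (h j)) ∧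
      (∀ i, D i i = -∑ j ∈ Finset.univ.erase i, D j i) ∧
      ∀ i j, i ≠ j →
        D i j = D j i ∧
        -- cells without a common point in `Ω`
        (edge Ω p r i j = ∅ → D i j = 0) ∧
        -- otherwise the common edge is a geodesic segment on the bisector
        ((edge Ω p r i j).Nonempty → ∃ q u n γi γj dk dl,
          BisectorFrame (p i) (p j) (r i) (r j) q u n γi γj ∧ -dl ≤ dk ∧
          edge Ω p r i j = geo q n '' Set.Icc (-dl) dk) ∧
        -- and its end points, at signed distances `dk` and `dl` from `q`, give the derivative
        (∀ q u n γi γj dk dl, BisectorFrame (p i) (p j) (r i) (r j) q u n γi γj → -dl ≤ dk →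
          edge Ω p r i j = geo q n '' Set.Icc (-dl) dk →
          D i j = -(Real.sinh dk + Real.sinh dl) / (Real.tanh γi + Real.tanh γj)) ∧
        -- in particular for the power centres of two triangles on both sides of `p i`, `p j`
        (∀ q u n γi γj dk dl k l, BisectorFrame (p i) (p j) (r i) (r j) q u n γi γj →
          0 < lor (p k) n → lor (p l) n < 0 →
          geo q n dk ∈ edge Ω p r i j ∩ cell p r k →
          geo q n (-dl) ∈ edge Ω p r i j ∩ cell p r l →
          D i j = -(Real.sinh dk + Real.sinh dl) / (Real.tanh γi + Real.tanh γj)) := by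
  have hpH : ∀ i, p i ∈ hypPlane := fun i => hΩ (hp i)
  have hpos : ∀ i, 0 < h i := fun i => by
    rw [hh i]; exact Real.log_pos (Real.one_lt_cosh.2 (hr i).ne')
  have hexp : ∀ i, Real.cosh (r i) = Real.exp (h i) := fun i => by
    rw [hh i, Real.exp_log (Real.cosh_pos _)]
  -- the frame and the end points of a nonempty edge
  have hedge : ∀ i j, i ≠ j → (edge Ω p r i j).Nonempty → ∃ q u n γi γj dk dl,
      BisectorFrame (p i) (p j) (r i) (r j) q u n γi γj ∧ -dl ≤ dk ∧
      edge Ω p r i j = geo q n '' Set.Icc (-dl) dk := by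
    intro i j hij hE
    obtain ⟨x, hx⟩ := id hE
    obtain ⟨q, u, n, γi, γj, B⟩ := exists_bisectorFrame (hpH i) (hpH j) (hinj.ne hij) (hΩ hx.2)
      (pow_eq_of_mem_cells hx.1.1 hx.1.2)
    obtain ⟨dk, dl, hd, hEq⟩ := exists_edge_eq hΩ hcompact hconvex hpH B hE
    exact ⟨q, u, n, γi, γj, dk, dl, B, hd, hEq⟩
  have hformula : ∀ i j, i ≠ j → ∀ q u n γi γj dk dl,
      BisectorFrame (p i) (p j) (r i) (r j) q u n γi γj → -dl ≤ dk →
      edge Ω p r i j = geo q n '' Set.Icc (-dl) dk →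
      HasDerivAt (fun t => cellArea Ω p (Function.update h j t) i)
        (-(Real.sinh dk + Real.sinh dl) / (Real.tanh γi + Real.tanh γj)) (h j) :=
    fun i j hij q u n γi γj dk dl B hd hE =>
      hasDerivAt_cellArea_of_edge_eq hΩ hcompact hconvex hpH hinj hnondeg hpos hexp hij B hd hE
  have hempty : ∀ i j, i ≠ j → edge Ω p r i j = ∅ →
      HasDerivAt (fun t => cellArea Ω p (Function.update h j t) i) 0 (h j) :=
    fun i j hij hE => hasDerivAt_cellArea_of_edge_eq_empty hΩ hcompact hpH hpos hexp hij hE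
  let D : Fin N → Fin N → ℝ := fun i j =>
    deriv (fun t => cellArea Ω p (Function.update h j t) i) (h j)
  have hoff : ∀ i j, i ≠ j →
      HasDerivAt (fun t => cellArea Ω p (Function.update h j t) i) (D i j) (h j) := by
    intro i j hij
    rcases Set.eq_empty_or_nonempty (edge Ω p r i j) with hE | hE
    · exact (hempty i j hij hE).differentiableAt.hasDerivAt
    · obtain ⟨q, u, n, γi, γj, dk, dl, B, hd, hEq⟩ := hedge i j hij hE
      exact (hformula i j hij q u n γi γj dk dl B hd hEq).differentiableAt.hasDerivAt
  have hdiag : ∀ i, HasDerivAt (fun t => cellArea Ω p (Function.update h i t) i)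
      (-∑ j ∈ Finset.univ.erase i, D j i) (h i) := fun i =>
    hasDerivAt_cellArea_self hΩ hcompact hpH hinj fun j hji => hoff j i hji
  refine ⟨D, fun i j => ?_, fun i => (hdiag i).deriv, fun i j hij =>
    ⟨?_, fun hE => (hempty i j hij hE).deriv, hedge i j hij,
      fun q u n γi γj dk dl B hd hE => (hformula i j hij q u n γi γj dk dl B hd hE).deriv, ?_⟩⟩
  · rcases eq_or_ne i j with rfl | hij
    · exact (hdiag i).differentiableAt.hasDerivAt
    · exact hoff i j hij
  · rcases Set.eq_empty_or_nonempty (edge Ω p r i j) with hE | hE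
    · exact (hempty i j hij hE).deriv.trans
        (hempty j i hij.symm (by rw [edge_comm]; exact hE)).deriv.symm
    · obtain ⟨q, u, n, γi, γj, dk, dl, B, hd, hEq⟩ := hedge i j hij hE
      refine (hformula i j hij q u n γi γj dk dl B hd hEq).deriv.trans ?_
      rw [add_comm (Real.tanh γi)]
      exact (hformula j i hij.symm q (-u) n γj γi dk dl B.swap hd
        (by rw [edge_comm]; exact hEq)).deriv.symm
  · intro q u n γi γj dk dl k l B hk hl hdk hdl
    obtain ⟨hd, hE⟩ := edge_eq_of_power_centres hΩ hcompact hconvex hpH B hk hl hdk hdl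
    exact (hformula i j hij q u n γi γj dk dl B hd hE).deriv
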